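/- Let $\mathbb K$ be $\mathbb R$ or $\mathbb C$ and $\mathbb N=\{1,2,\dots\}$. Let $C(2^{\mathbb N})$ be the Banach space of continuous $\mathbb K$-valued functions on the Cantor set, and let $\mathbf{SB}$ be the set of its closed linear subspaces with the Effros Borel structure, i.e. the $\sigma$-algebra generated by the sets $\{X: X\cap U\neq\varnothing\}$, $U\subseteq C(2^{\mathbb N})$ open. Let $d_n:\mathbf{SB}\to C(2^{\mathbb N})$ ($n\in\mathbb N$) be Borel maps such that $X=\overline{\{d_n(X):n\in\mathbb N\}}$ for all $X\in\mathbf{SB}$. Let $\mathcal L$ be the set of all $(X,Y,(y_n)_{n=1}^\infty)\in\mathbf{SB}\times\mathbf{SB}\times C(2^{\mathbb N})^{\mathbb N}$ such that $y_n\in Y$ for all $n$ and, for some $k\in\mathbb N$, $\|\sum_{i=1}^n a_iy_i\|\le k\|\sum_{i=1}^n a_id_i(X)\|$ for all $n$ and all scalars $a_1,\dots,a_n$. The triple $(X,Y,(y_n))$ codes the unique bounded operator $A:X\to Y$ with $Ad_n(X)=y_n$ for all $n$. Equip $\mathcal L$ with the trace of the product $\sigma$-algebra. The families $\mathcal S_\xi$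 ($\xi<\omega_1$) of finite subsets of $\mathbb N$ are Schreier families: $\mathcal S_0=\{E:|E|\le1\}$; $\mathcal S_{\xi+1}$ consists of $\varnothing$ and all $\bigcup_{i=1}^nE_i$ with $\varnothing\ne E_i\in\mathcal S_\xi$, $E_1<\dots<E_n$ and $n\le\min E_1$; and for limit $\xi$ there is a strictly increasing sequence $(\xi_n)_{n=1}^\infty$ with supremum $\xi$ such that $\mathcal S_{\xi_n+1}\subseteq\mathcal S_{\xi_{n+1}}$ for all $n$ and $\mathcal S_\xi=\{E:\exists n\ (n\le E\text{ and }E\in\mathcal S_{\xi_n+1})\}$, where $n\le E$ means that $n\le m$ for all $m\in E$. A sequence $(x_n)_{n=1}^\infty$ in a Banach space $X$ is $\xi$-weakly null if there are no $\varepsilon>0$ and $n_1<n_2<\cdots$ in $\mathbb N$ such that for every $E\in\mathcal S_\xi$ some $x^*\in B_{X^*}$ satisfies $|x^*(x_{n_i})|\ge\varepsilon$ for all $i\in E$. An operator is ($\xi$-)completely continuous if it maps ($\xi$-)weakly null sequences to norm null sequences; $\mathfrak V$ and $\mathfrak V_\xi$ are the classes of completely continuous and of $\xi$-completely continuous operators,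 and $\mathfrak V\cap\mathcal L$, $\mathfrak V_\xi\cap\mathcal L$ are the sets of codes of their members. In a Polish space, $\Pi^1_1$ sets are complements of analytic sets, $\Sigma^1_2$ sets are continuous images of $\Pi^1_1$ subsets of Polish spaces, and $\Pi^1_2$ sets are complements of $\Sigma^1_2$ sets. A set $A$ is Borel reducible to $B$ if $A=f^{-1}(B)$ for some Borel map $f$; a $\Pi^1_2$ set is $\Pi^1_2$-complete if every $\Pi^1_2$ subset of every Polish space is Borel reducible to it. Then $\mathcal L$ is a standard Borel space and, with respect to every Polish topology on $\mathcal L$ generating its $\sigma$-algebra: 1. $\mathfrak V\cap\mathcal L$ is $\Pi^1_2$, in fact $\Pi^1_2$-complete; 2. $\mathfrak V\cap\mathcal L$ is strictly more complex than each $\mathfrak V_\xi\cap\mathcal L$, $0<\xi<\omega_1$: every $\mathfrak V_\xi\cap\mathcal L$ is $\Pi^1_1$ while $\mathfrak V\cap\mathcal L$ is not $\Pi^1_1$, and $\mathfrak V_\xi\cap\mathcal L$ is Borel reducible to $\mathfrak V\cap\mathcal L$ but not conversely. -/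

import Mathlib

open Filter Topology MeasureTheory

/-! ### Projective classes in Polish spaces -/

/-- Coanalytic (`Π¹₁`) sets. -/
def IsPi11 {P : Type} [TopologicalSpace P] (T : Set P) : Prop :=
  AnalyticSet Tᶜ

/-- `Σ¹₂` sets: continuous images of coanalytic subsets of Polish spaces. -/
def IsSigma12 {P : Type} [TopologicalSpace P] (T : Set P) : Prop :=
  ∃ (Y : Type) (_ : TopologicalSpace Y) (_ : PolishSpace Y) (A : Set Y) (f : Y → P),
    IsPi11 A ∧ Continuous f ∧ f '' A = T

/-- `Π¹₂` sets: complements of `Σ¹₂` sets. -/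
def IsPi12 {P : Type} [TopologicalSpace P] (T : Set P) : Prop :=
  IsSigma12 Tᶜ

/-- `A ⊆ Y` is Borel reducible to `B ⊆ P`: it is the preimage of `B` under a Borel map. -/
def BorelReducible {Y P : Type} [TopologicalSpace Y] [TopologicalSpace P]
    (A : Set Y) (B : Set P) : Prop :=
  ∃ f : Y → P, @Measurable Y P (borel Y) (borel P) f ∧ f ⁻¹' B = A

/-- `Π¹₂`-complete sets. -/
def IsPi12Complete {P : Type} [TopologicalSpace P] (B : Set P) : Prop :=
  IsPi12 B ∧ ∀ (Y : Type) [TopologicalSpace Y] [PolishSpace Y] (A : Set Y),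
    IsPi12 A → BorelReducible A B

/-! ### Weakly null sequences and completely continuous operators -/

section Operators

variable (𝕂 : Type) [RCLike 𝕂] {E F : Type}
  [NormedAddCommGroup E] [NormedSpace 𝕂 E] [NormedAddCommGroup F] [NormedSpace 𝕂 F]

/-- Weakly null sequences. -/
def IsWeaklyNull (x : ℕ → E) : Prop :=
  ∀ f : StrongDual 𝕂 E, Tendsto (fun n => f (x n)) atTop (𝓝 0)

variable {𝕂} in
/-- Completely continuous operators. -/
def IsCompletelyContinuous (A : E →L[𝕂] F) : Prop :=
  ∀ x : ℕ → E, IsWeaklyNull 𝕂 x → Tendsto (fun n => A (x n)) atTop (𝓝 0)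

/-- The finite sets `G` of positive integers for which some functional of norm at most one
has modulus at least `ε` at every `x n` with `n ∈ G`. -/
def largeSets (ε : ℝ) (x : ℕ+ → E) : Set (Finset ℕ+) :=
  {G | ∃ f : StrongDual 𝕂 E, ‖f‖ ≤ 1 ∧ ∀ n ∈ G, ε ≤ ‖f (x n)‖}

/-- `S` is a choice of the Schreier families `S ξ`, `ξ < ω₁`. -/
structure IsSchreierSystem (S : Ordinal.{0} → Set (Finset ℕ+)) : Prop where
  zero : S 0 = {G | G.card ≤ 1}
  succ : ∀ ξ < Ordinal.omega 1, S (ξ + 1) =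
    {G | G = ∅ ∨ ∃ (n : ℕ) (H : Fin n → Finset ℕ+),
      (∀ i, (H i).Nonempty ∧ H i ∈ S ξ) ∧
      (∀ i, ∀ a ∈ H i, n ≤ (a : ℕ)) ∧
      (∀ i j, i < j → ∀ a ∈ H i, ∀ b ∈ H j, a < b) ∧
      G = Finset.univ.biUnion H}
  limit : ∀ ξ < Ordinal.omega 1, Order.IsSuccLimit ξ →
    ∃ ζ : ℕ+ → Ordinal.{0}, StrictMono ζ ∧ (∀ n, ζ n < ξ) ∧ (∀ η < ξ, ∃ n, η < ζ n) ∧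
      (∀ n, S (ζ n + 1) ⊆ S (ζ (n + 1))) ∧
      S ξ = {G | ∃ n : ℕ+, (∀ a ∈ G, n ≤ a) ∧ G ∈ S (ζ n + 1)}

/-- With `𝓕` the Schreier family of order `ξ`, these are the `ξ`-weakly null sequences. The infinite
set `N` of positive integers is given by its increasing enumeration. -/
def IsFamilyWeaklyNull (𝓕 : Set (Finset ℕ+)) (x : ℕ+ → E) : Prop :=
  ¬ ∃ (ε : ℝ) (N : ℕ+ → ℕ+), 0 < ε ∧ StrictMono N ∧ ∀ G ∈ 𝓕, G.image N ∈ largeSets 𝕂 ε x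

variable {𝕂} in
/-- With `𝓕` the Schreier family of order `ξ`, these are the `ξ`-completely continuous
operators. -/
def IsFamilyCompletelyContinuous (𝓕 : Set (Finset ℕ+)) (A : E →L[𝕂] F) : Prop :=
  ∀ x : ℕ+ → E, IsFamilyWeaklyNull 𝕂 𝓕 x → Tendsto (fun n => A (x n)) atTop (𝓝 0)

end Operators

/-! ### The coding of separable Banach spaces and of their operators -/

section Coding

variable (𝕂 : Type) [RCLike 𝕂]

/-- Scalar-valued continuous functions on the Cantor set, with the sup norm. -/
abbrev CantorC : Type := C(ℕ → Bool, 𝕂)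

instance : MeasurableSpace (CantorC 𝕂) := borel _

instance : BorelSpace (CantorC 𝕂) := ⟨rfl⟩

/-- Closed linear subspaces of `C(2^ℕ)`. -/
abbrev SB : Type := ClosedSubmodule 𝕂 (CantorC 𝕂)

/-- The Effros Borel structure. -/
instance : MeasurableSpace (SB 𝕂) :=
  MeasurableSpace.generateFrom
    {W | ∃ U : Set (CantorC 𝕂), IsOpen U ∧ W = {X : SB 𝕂 | ((X : Set (CantorC 𝕂)) ∩ U).Nonempty}}

/-- A sequence of Borel maps `d n : SB → C(2^ℕ)` such that `X` is the closure of
`{d n X : n ∈ ℕ}` for every `X`. -/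
structure DenseSelector where
  d : ℕ → SB 𝕂 → CantorC 𝕂
  measurable : ∀ n, Measurable (d n)
  closure_eq : ∀ X : SB 𝕂, closure (Set.range fun n => d n X) = (X : Set (CantorC 𝕂))

variable {𝕂}

/-- The space `𝓛` of codes `(X, Y, (yₙ))` of operators, with `yₙ ∈ Y` the image of `dₙ(X)`. It
carries the `σ`-algebra induced by the product `σ`-algebra. -/
abbrev OperatorCode (s : DenseSelector 𝕂) : Type :=
  {c : SB 𝕂 × SB 𝕂 × (ℕ → CantorC 𝕂) //
    (∀ n, c.2.2 n ∈ c.2.1) ∧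
    ∃ k : ℕ, ∀ (n : ℕ) (a : ℕ → 𝕂),
      ‖∑ i ∈ Finset.range n, a i • c.2.2 i‖ ≤ k * ‖∑ i ∈ Finset.range n, a i • s.d i c.1‖}

namespace OperatorCode

variable {s : DenseSelector 𝕂}

/-- The domain of the coded operator. -/
abbrev dom (c : OperatorCode s) : Submodule 𝕂 (CantorC 𝕂) := c.1.1.toSubmodule

/-- The codomain of the coded operator. -/
abbrev cod (c : OperatorCode s) : Submodule 𝕂 (CantorC 𝕂) := c.1.2.1.toSubmodule

instance (c : OperatorCode s) : CompleteSpace c.cod :=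
  c.1.2.1.isClosed.completeSpace_coe

/-- The element `dₙ(X)` of the domain. -/
def point (c : OperatorCode s) (n : ℕ) : c.dom :=
  ⟨s.d n c.1.1, by
    have h : s.d n c.1.1 ∈ (c.1.1 : Set (CantorC 𝕂)) := by
      rw [← s.closure_eq c.1.1]
      exact subset_closure ⟨n, rfl⟩
    exact h⟩

/-- The element `yₙ` of the codomain. -/
def value (c : OperatorCode s) (n : ℕ) : c.cod :=
  ⟨c.1.2.2 n, c.2.1 n⟩

/-- The operator coded by `c`: the continuous linear extension to `X` of the map
`∑ aᵢ dᵢ(X) ↦ ∑ aᵢ yᵢ`. See `operator_eq_iff`. -/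
noncomputable def operator (c : OperatorCode s) : c.dom →L[𝕂] c.cod :=
  LinearMap.extendOfNorm (Finsupp.linearCombination 𝕂 c.value)
    (Finsupp.linearCombination 𝕂 c.point)

theorem point_denseRange (c : OperatorCode s) : DenseRange c.point := by
  rw [DenseRange, dense_iff_closure_eq, Set.eq_univ_iff_forall]
  intro x
  rw [closure_subtype]
  have hx : (x : CantorC 𝕂) ∈ (c.1.1 : Set (CantorC 𝕂)) := x.2
  rw [← s.closure_eq c.1.1] at hx
  rw [← Set.range_comp]
  exact hx

theorem linearCombination_bound (c : OperatorCode s) :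
    ∃ C : ℝ, ∀ a : ℕ →₀ 𝕂, ‖Finsupp.linearCombination 𝕂 c.value a‖ ≤
      C * ‖Finsupp.linearCombination 𝕂 c.point a‖ := by
  obtain ⟨k, hk⟩ := c.2.2
  refine ⟨k, fun a => ?_⟩
  obtain ⟨n, hn⟩ := a.support.exists_nat_subset_range
  rw [Finsupp.linearCombination_apply, Finsupp.linearCombination_apply,
    Finsupp.sum_of_support_subset a hn _ (by simp),
    Finsupp.sum_of_support_subset a hn _ (by simp)]
  have h := hk n a
  change ‖((∑ i ∈ Finset.range n, a i • c.value i : c.cod) : CantorC 𝕂)‖ ≤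
    k * ‖((∑ i ∈ Finset.range n, a i • c.point i : c.dom) : CantorC 𝕂)‖
  rw [Submodule.coe_sum, Submodule.coe_sum]
  exact h

theorem linearCombination_denseRange (c : OperatorCode s) :
    DenseRange (Finsupp.linearCombination 𝕂 c.point) :=
  c.point_denseRange.mono (by
    rintro _ ⟨n, rfl⟩
    exact ⟨Finsupp.single n 1, by simp⟩)

/-- The coded operator is the unique bounded operator that maps `dₙ(X)` to `yₙ` for every `n`. -/
theorem operator_eq_iff (c : OperatorCode s) (A : c.dom →L[𝕂] c.cod) :
    c.operator = A ↔ ∀ n, A (c.point n) = c.value n := by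
  constructor
  · rintro rfl n
    have h := LinearMap.extendOfNorm_eq c.linearCombination_denseRange c.linearCombination_bound
      (Finsupp.single n 1)
    simpa [operator] using h
  · intro h
    obtain ⟨C, hC⟩ := c.linearCombination_bound
    refine LinearMap.extendOfNorm_unique c.linearCombination_denseRange C hC A ?_
    ext n
    simp [h n]

end OperatorCode

/-- The class of completely continuous operators, as a subset of `𝓛`. -/
def completelyContinuousCodes (s : DenseSelector 𝕂) : Set (OperatorCode s) :=
  {c | IsCompletelyContinuous c.operator}

/-- With `𝓕` the Schreier family of order `ξ`, the class of `ξ`-completely continuous operators,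
as a subset of `𝓛`. -/
def familyCompletelyContinuousCodes (s : DenseSelector 𝕂) (𝓕 : Set (Finset ℕ+)) :
    Set (OperatorCode s) :=
  {c | IsFamilyCompletelyContinuous 𝓕 c.operator}

end Coding

/-! ### Analytic and coanalytic sets -/

/-! Upper bounds. Failure of complete continuity is witnessed by a weakly null sequence whose images
stay away from 0. By density its terms may be taken among the `dₙ(X)`, so the witness is a sequence
of integers (`not_isFamilyCompletelyContinuous_iff`). By Banach–Alaoglu, weak nullness is the case
of the family of all finite sets, and being `ε`-large is a closed condition on the sequence. Hence
weak nullness is coanalytic and `𝔙` is `Π¹₂`. For `0 < ξ < ω₁` the universal quantifier over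
subsequences can be removed. `S ξ` is a diagonal union of families `𝓖 n` of rank below `ω ^ ξ`. By a
Ramsey dichotomy for hereditary families, a `ξ`-weakly null sequence has a subsequence whose
`ε`-large sets, up to a tail, are carried into a single `𝓖 n`, for every `ε`. Conversely such a
containment forces `ξ`-weak nullness, because every tail of `S ξ` has rank at least `ω ^ ξ`. The
containment is a Borel condition, so `𝔙_ξ` is `Π¹₁`.

Completeness. A hereditary family `𝓕` containing the singletons yields the closed span of the
functions extending `E ↦ 1_E(n)`; composition with `E ↦ {min E}` reads off the coordinates `x({n})`.
This operator is completely continuous if and only if every infinite `M` contains an infinite `E`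
with all finite subsets in `𝓕`: a gliding hump argument gives one direction, and weakly null basis
functions the other. The complement of a `Π¹₂` set has the form `{y : ∃ σ, p σ = y and σ ∉ proj D}`
with `p` continuous and `D` closed. The members of `treeFamily D p y` are finite sets of nodes that
contain no nested pair, or lie on a branch with a witness in `D` of controlled growth, or lie on a
branch whose image is visibly different from `y`. By Ramsey's theorem only branches matter, and the
branch `σ` is an obstruction exactly when `p σ = y` and `σ ∉ proj D`.

The comparison follows: analytic and coanalytic sets are `Π¹₂`, some analytic set is not coanalytic,
and `Π¹₁` is stable under Borel reductions. -/

theorem MeasureTheory.AnalyticSet.exists_isClosed_image_fst {P : Type*} [TopologicalSpace P]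
    [T2Space P] {B : Set P} (h : AnalyticSet B) :
    ∃ D : Set (P × (ℕ → ℕ)), IsClosed D ∧ Prod.fst '' D = B := by
  rw [AnalyticSet] at h
  rcases h with rfl | ⟨f, hf, rfl⟩
  · exact ⟨∅, isClosed_empty, by simp⟩
  · refine ⟨{x | x.1 = f x.2}, isClosed_eq continuous_fst (hf.comp continuous_snd), ?_⟩
    ext p
    constructor
    · rintro ⟨⟨a, b⟩, h, rfl⟩
      exact ⟨b, h.symm⟩
    · rintro ⟨b, rfl⟩
      exact ⟨(f b, b), rfl, rfl⟩

theorem MeasureTheory.AnalyticSet.preimage_measurable {Y P : Type*} [TopologicalSpace Y]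
    [PolishSpace Y] [MeasurableSpace Y] [BorelSpace Y] [TopologicalSpace P] [PolishSpace P]
    [MeasurableSpace P] [BorelSpace P] {B : Set P} (hB : AnalyticSet B) {f : Y → P}
    (hf : Measurable f) : AnalyticSet (f ⁻¹' B) := by
  obtain ⟨D, hD, rfl⟩ := hB.exists_isClosed_image_fst
  have hm : MeasurableSet {x : Y × (ℕ → ℕ) | (f x.1, x.2) ∈ D} :=
    ((hf.comp measurable_fst).prodMk measurable_snd) hD.measurableSet
  convert hm.analyticSet_image measurable_fst using 1
  ext y
  constructor
  · rintro ⟨⟨p, z⟩, h, rfl : p = f y⟩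
    exact ⟨(y, z), h, rfl⟩
  · rintro ⟨⟨y', z⟩, h, rfl⟩
    exact ⟨(f y', z), h, rfl⟩

theorem IsPi11.of_borelReducible {Y P : Type} [TopologicalSpace Y] [PolishSpace Y]
    [TopologicalSpace P] [PolishSpace P] {A : Set Y} {B : Set P} (h : BorelReducible A B)
    (hB : IsPi11 B) : IsPi11 A := by
  obtain ⟨f, hf, rfl⟩ := h
  borelize Y P
  exact AnalyticSet.preimage_measurable hB hf

theorem isSigma12_of_isPi11 {P : Type} [TopologicalSpace P] [PolishSpace P] {A : Set P}
    (h : IsPi11 A) : IsSigma12 A :=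
  ⟨P, inferInstance, inferInstance, A, id, h, continuous_id, Set.image_id A⟩

theorem isPi12_of_analyticSet {P : Type} [TopologicalSpace P] [PolishSpace P] {A : Set P}
    (h : AnalyticSet A) : IsPi12 A :=
  isSigma12_of_isPi11 (by rwa [IsPi11, compl_compl])

/-- The complement, if nonempty, is a continuous image of the whole Baire space, which is coanalytic
in itself. -/
theorem isPi12_of_isPi11 {P : Type} [TopologicalSpace P] {A : Set P}
    (h : IsPi11 A) : IsPi12 A := by
  rw [IsPi11, AnalyticSet] at h
  rcases h with h | ⟨f, hf, h⟩
  · exact ⟨Empty, ⊥, inferInstance, ∅, Empty.elim, by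
      rw [IsPi11, Set.compl_empty]; exact isClosed_univ.analyticSet, by
      fun_prop, by rw [h, Set.image_empty]⟩
  · exact ⟨ℕ → ℕ, inferInstance, inferInstance, Set.univ, f, by
      rw [IsPi11, Set.compl_univ]; exact analyticSet_empty, hf, by rw [Set.image_univ, h]⟩

/-- A universal analytic subset of the Baire space, restricted to the diagonal. -/
theorem exists_analyticSet_not_isPi11 : ∃ A : Set (ℕ → ℕ), AnalyticSet A ∧ ¬ IsPi11 A := by
  let code : (ℕ → ℕ) → (ℕ → ℕ) → ℕ → ℕ := fun x z n =>
    Encodable.encode ((List.range n).map x, (List.range n).map z)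
  have hcode : ∀ n, Continuous fun q : (ℕ → ℕ) × (ℕ → ℕ) => code q.1 q.2 n := by
    intro n
    have h1 : Continuous fun q : (ℕ → ℕ) × (ℕ → ℕ) =>
        ((fun i : Fin n => q.1 i), (fun i : Fin n => q.2 i)) := by fun_prop
    have h2 : Continuous fun w : (Fin n → ℕ) × (Fin n → ℕ) =>
      Encodable.encode (List.ofFn w.1, List.ofFn w.2) := continuous_of_discreteTopology
    convert h2.comp h1 using 2 with q
    simp only [code, Function.comp]
    congr 2 <;> apply List.ext_getElem <;> simp
  have happ : Continuous fun w : ((ℕ → ℕ) × ℕ) => w.1 w.2 :=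
    continuous_prod_of_discrete_right.2 fun n => continuous_apply n
  have hD : IsClosed {q : (ℕ → ℕ) × (ℕ → ℕ) | ∀ n, q.1 (code q.1 q.2 n) = 0} := by
    simp only [Set.ofPred_forall]
    exact isClosed_iInter fun n =>
      isClosed_eq (happ.comp (continuous_fst.prodMk (hcode n))) continuous_const
  refine ⟨Prod.fst '' _, hD.analyticSet.image_of_continuous continuous_fst, fun h => ?_⟩
  obtain ⟨C, hC, hCA⟩ := AnalyticSet.exists_isClosed_image_fst h
  classical
  -- `x` codes the tree of finite approximations to points of `C`. Since `C` is closed, the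
  -- universal closed set and `C` have the same section at `x`; as `C` projects onto the complement,
  -- membership of `x` contradicts itself.
  let x : ℕ → ℕ := fun k => if ∃ q ∈ C, ∃ n, code q.1 q.2 n = k then 0 else 1
  have key : ∀ z, (∀ n, x (code x z n) = 0) ↔ (x, z) ∈ C := by
    intro z
    constructor
    · intro hz
      have hz' : ∀ n, ∃ q ∈ C, ∀ i < n, q.1 i = x i ∧ q.2 i = z i := by
        intro n
        have h0 := hz n
        by_cases hq : ∃ q ∈ C, ∃ m, code q.1 q.2 m = code x z n
        · obtain ⟨q, hq, m, hm⟩ := hq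
          have hm := Encodable.encode_injective hm
          rw [Prod.mk.injEq] at hm
          have hlen : m = n := by simpa using congrArg List.length hm.1
          subst hlen
          refine ⟨q, hq, fun i hi => ⟨?_, ?_⟩⟩
          · simpa [hi] using congrArg (fun l => l[i]?) hm.1
          · simpa [hi] using congrArg (fun l => l[i]?) hm.2
        · simp only [x] at h0
          rw [if_neg hq] at h0
          omega
      choose q hqC hq using hz'
      refine hC.mem_of_tendsto (f := q) (b := atTop) ?_ (Eventually.of_forall hqC)
      rw [nhds_prod_eq]
      refine Tendsto.prodMk (f := atTop) ?_ ?_ <;>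
      · rw [tendsto_pi_nhds]
        intro i
        refine tendsto_const_nhds.congr' ?_
        filter_upwards [eventually_gt_atTop i] with n hn
        first | exact ((hq n i hn).1).symm | exact ((hq n i hn).2).symm
    · intro hz n
      exact if_pos ⟨_, hz, n, rfl⟩
  have h1 : (x ∈ Prod.fst '' {q : (ℕ → ℕ) × (ℕ → ℕ) | ∀ n, q.1 (code q.1 q.2 n) = 0}) ↔
      x ∈ Prod.fst '' C := by
    constructor
    · rintro ⟨⟨_, z⟩, h, rfl⟩
      exact ⟨(x, z), (key z).1 h, rfl⟩
    · rintro ⟨⟨x', z⟩, h, h' : x' = x⟩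
      subst h'
      exact ⟨(x, z), (key z).2 h, rfl⟩
  rw [hCA, Set.mem_compl_iff] at h1
  exact (iff_not_self h1)

/-! ### The coding spaces are standard Borel -/

theorem MeasurableEquiv.standardBorelSpace {X Y : Type*} [MeasurableSpace X] [MeasurableSpace Y]
    [StandardBorelSpace Y] (e : X ≃ᵐ Y) : StandardBorelSpace X := by
  let := upgradeStandardBorel Y
  let : TopologicalSpace X := TopologicalSpace.induced e inferInstance
  have he : IsClosedEmbedding e :=
    (e.toEquiv.toHomeomorphOfIsInducing ⟨rfl⟩).isClosedEmbedding
  have : PolishSpace X := he.polishSpace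
  have : BorelSpace X := ⟨by
    refine e.measurableEmbedding.comap_eq.symm.trans (Eq.trans ?_ borel_comap.symm)
    exact congrArg (MeasurableSpace.comap e) (eq_borel_upgradeStandardBorel Y)⟩
  infer_instance

section SB

variable {𝕂 : Type} [RCLike 𝕂]

instance standardBorelSpace_cantorC : StandardBorelSpace (CantorC 𝕂) := inferInstance

theorem DenseSelector.d_mem (s : DenseSelector 𝕂) (n : ℕ) (X : SB 𝕂) : s.d n X ∈ X := by
  have h : s.d n X ∈ (X : Set (CantorC 𝕂)) := by
    rw [← s.closure_eq X]
    exact subset_closure ⟨n, rfl⟩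
  exact h

theorem measurableSet_mem_SB (s : DenseSelector 𝕂) :
    MeasurableSet {p : SB 𝕂 × CantorC 𝕂 | p.2 ∈ p.1} := by
  have h : {p : SB 𝕂 × CantorC 𝕂 | p.2 ∈ p.1} =
      ⋂ k : ℕ, ⋃ n : ℕ, {p | dist p.2 (s.d n p.1) < 1 / ((k : ℝ) + 1)} := by
    ext p
    simp only [Set.mem_ofPred_eq, Set.mem_iInter, Set.mem_iUnion]
    have : p.2 ∈ p.1 ↔ p.2 ∈ closure (Set.range fun n => s.d n p.1) := by
      rw [s.closure_eq]; rfl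
    rw [this, Metric.mem_closure_range_iff]
    constructor
    · intro h k
      exact h _ Nat.one_div_pos_of_nat
    · intro h ε hε
      obtain ⟨k, hk⟩ := exists_nat_one_div_lt hε
      obtain ⟨n, hn⟩ := h k
      exact ⟨n, hn.trans hk⟩
  rw [h]
  refine MeasurableSet.iInter fun k => MeasurableSet.iUnion fun n => ?_
  exact measurableSet_lt (measurable_snd.dist ((s.measurable n).comp measurable_fst))
    measurable_const

/-- A closed subspace is recovered from its selected dense sequence. So `SB` is isomorphic to the
set of sequences whose closure is a subspace and which the selector returns for that subspace; both
conditions are Borel. -/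
theorem standardBorelSpace_SB (s : DenseSelector 𝕂) : StandardBorelSpace (SB 𝕂) := by
  -- Countably many scalars and errors keep the condition Borel; stability of the closure under all
  -- linear combinations follows by continuity.
  let V : Set (ℕ → CantorC 𝕂) := {x | ∀ i m n j : ℕ, ∃ k,
    dist (TopologicalSpace.denseSeq 𝕂 i • x m + x n) (x k) < 1 / ((j : ℝ) + 1)}
  have hV : MeasurableSet V := by
    simp only [V, Set.ofPred_forall, Set.ofPred_exists]
    refine MeasurableSet.iInter fun i => MeasurableSet.iInter fun m => MeasurableSet.iInter
      fun n => MeasurableSet.iInter fun j => MeasurableSet.iUnion fun k => ?_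
    refine IsOpen.measurableSet (isOpen_lt ?_ continuous_const)
    fun_prop
  have hsub : ∀ x ∈ V, ∀ a : 𝕂, ∀ u ∈ closure (Set.range x), ∀ v ∈ closure (Set.range x),
      a • u + v ∈ closure (Set.range x) := by
    intro x hx a u hu v hv
    have hmap : Set.MapsTo (fun q : 𝕂 × CantorC 𝕂 × CantorC 𝕂 => q.1 • q.2.1 + q.2.2)
        (closure (Set.range (TopologicalSpace.denseSeq 𝕂) ×ˢ (Set.range x ×ˢ Set.range x)))
        (closure (closure (Set.range x))) := by
      refine Set.MapsTo.closure ?_ (by fun_prop)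
      rintro ⟨_, _, _⟩ ⟨⟨i, rfl⟩, ⟨m, rfl⟩, ⟨n, rfl⟩⟩
      rw [Metric.mem_closure_range_iff]
      intro ε hε
      obtain ⟨j, hj⟩ := exists_nat_one_div_lt hε
      obtain ⟨k, hk⟩ := hx i m n j
      exact ⟨k, hk.trans hj⟩
    rw [closure_closure, closure_prod_eq, closure_prod_eq,
      (TopologicalSpace.denseRange_denseSeq 𝕂).closure_range] at hmap
    exact hmap (x := (a, u, v)) ⟨trivial, hu, hv⟩
  have hzero : ∀ x ∈ V, (0 : CantorC 𝕂) ∈ closure (Set.range x) := by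
    intro x hx
    have h0 : x 0 ∈ closure (Set.range x) := subset_closure ⟨0, rfl⟩
    simpa using hsub x hx (-1) _ h0 _ h0
  let g : V → SB 𝕂 := fun x =>
    { carrier := closure (Set.range x.1)
      add_mem' := fun {u v} hu hv => by simpa using hsub x x.2 1 u hu v hv
      zero_mem' := hzero x x.2
      smul_mem' := fun a u hu => by simpa using hsub x x.2 a u hu 0 (hzero x x.2)
      isClosed' := isClosed_closure }
  have hgcoe : ∀ x, (g x : Set (CantorC 𝕂)) = closure (Set.range x.1) := fun x => rfl
  have hg : Measurable g := by
    refine measurable_generateFrom ?_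
    rintro _ ⟨U, hU, rfl⟩
    have : g ⁻¹' {X : SB 𝕂 | ((X : Set (CantorC 𝕂)) ∩ U).Nonempty} =
        ⋃ n, {x : V | x.1 n ∈ U} := by
      ext x
      simp only [Set.mem_preimage, Set.mem_ofPred_eq, Set.mem_iUnion, hgcoe]
      rw [closure_inter_open_nonempty_iff hU]
      constructor
      · rintro ⟨_, ⟨n, rfl⟩, h⟩
        exact ⟨n, h⟩
      · rintro ⟨n, h⟩
        exact ⟨_, ⟨n, rfl⟩, h⟩
    rw [this]
    exact MeasurableSet.iUnion fun n =>
      ((measurable_pi_apply n).comp measurable_subtype_coe) hU.measurableSet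
  have hD : ∀ X : SB 𝕂, (fun n => s.d n X) ∈ V := by
    intro X i m n j
    have h : TopologicalSpace.denseSeq 𝕂 i • s.d m X + s.d n X ∈
        closure (Set.range fun n => s.d n X) := by
      rw [s.closure_eq]
      exact X.toSubmodule.add_mem (X.toSubmodule.smul_mem _ (s.d_mem m X)) (s.d_mem n X)
    exact Metric.mem_closure_range_iff.1 h _ Nat.one_div_pos_of_nat
  have hgD : ∀ X : SB 𝕂, g ⟨fun n => s.d n X, hD X⟩ = X := by
    intro X
    apply SetLike.coe_injective
    rw [hgcoe, ← s.closure_eq X]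
  have : StandardBorelSpace V := hV.standardBorel
  let R : Set V := {x | ∀ n, s.d n (g x) = x.1 n}
  have hR : MeasurableSet R := by
    simp only [R, Set.ofPred_forall]
    exact MeasurableSet.iInter fun n => measurableSet_eq_fun ((s.measurable n).comp hg)
      ((measurable_pi_apply n).comp measurable_subtype_coe)
  have : StandardBorelSpace R := hR.standardBorel
  let e : SB 𝕂 ≃ᵐ R :=
    { toFun := fun X => ⟨⟨fun n => s.d n X, hD X⟩, fun n => by rw [hgD]⟩
      invFun := fun x => g x.1
      left_inv := hgD
      right_inv := by
        rintro ⟨⟨x, hx⟩, hR⟩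
        apply Subtype.ext
        apply Subtype.ext
        funext n
        exact hR n
      measurable_toFun := by
        refine Measurable.subtype_mk (Measurable.subtype_mk ?_)
        exact measurable_pi_lambda _ s.measurable
      measurable_invFun := hg.comp measurable_subtype_coe }
  exact e.standardBorelSpace

/-- The norm bound is a closed condition on the coefficients, so it need only be tested on a dense
sequence of them. -/
theorem standardBorelSpace_operatorCode (s : DenseSelector 𝕂) :
    StandardBorelSpace (OperatorCode s) := by
  have := standardBorelSpace_SB s
  have h1 : ∀ n, MeasurableSet {c : SB 𝕂 × SB 𝕂 × (ℕ → CantorC 𝕂) | c.2.2 n ∈ c.2.1} := by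
    intro n
    have hf : Measurable fun c : SB 𝕂 × SB 𝕂 × (ℕ → CantorC 𝕂) => (c.2.1, c.2.2 n) :=
      (measurable_fst.comp measurable_snd).prodMk
        ((measurable_pi_apply n).comp (measurable_snd.comp measurable_snd))
    exact hf (measurableSet_mem_SB s)
  have h2 : ∀ (k n : ℕ), MeasurableSet {c : SB 𝕂 × SB 𝕂 × (ℕ → CantorC 𝕂) | ∀ a : ℕ → 𝕂,
      ‖∑ i ∈ Finset.range n, a i • c.2.2 i‖ ≤ k * ‖∑ i ∈ Finset.range n, a i • s.d i c.1‖} := by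
    intro k n
    have : {c : SB 𝕂 × SB 𝕂 × (ℕ → CantorC 𝕂) | ∀ a : ℕ → 𝕂,
        ‖∑ i ∈ Finset.range n, a i • c.2.2 i‖ ≤ k * ‖∑ i ∈ Finset.range n, a i • s.d i c.1‖} =
        ⋂ j : ℕ, {c | ‖∑ i ∈ Finset.range n, TopologicalSpace.denseSeq (ℕ → 𝕂) j i • c.2.2 i‖ ≤
          k * ‖∑ i ∈ Finset.range n, TopologicalSpace.denseSeq (ℕ → 𝕂) j i • s.d i c.1‖} := by
      ext c
      simp only [Set.mem_ofPred_eq, Set.mem_iInter]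
      refine ⟨fun h j => h _, fun h a => ?_⟩
      have hcl : IsClosed {a : ℕ → 𝕂 | ‖∑ i ∈ Finset.range n, a i • c.2.2 i‖ ≤
          k * ‖∑ i ∈ Finset.range n, a i • s.d i c.1‖} :=
        isClosed_le (by fun_prop) (by fun_prop)
      have := (TopologicalSpace.denseRange_denseSeq (ℕ → 𝕂)).closure_range
      have hsub : closure (Set.range (TopologicalSpace.denseSeq (ℕ → 𝕂))) ⊆ _ :=
        closure_minimal (by rintro _ ⟨j, rfl⟩; exact h j) hcl
      rw [this] at hsub
      exact hsub (Set.mem_univ a)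
    rw [this]
    refine MeasurableSet.iInter fun j => measurableSet_le ?_ ?_
    · refine Measurable.norm (Finset.measurable_sum _ fun i _ => ?_)
      have h : Measurable fun c : SB 𝕂 × SB 𝕂 × (ℕ → CantorC 𝕂) => c.2.2 i :=
        (measurable_pi_apply i).comp (measurable_snd.comp measurable_snd)
      exact h.const_smul (TopologicalSpace.denseSeq (ℕ → 𝕂) j i)
    · refine Measurable.const_mul (Measurable.norm (Finset.measurable_sum _ fun i _ => ?_)) _
      have h : Measurable fun c : SB 𝕂 × SB 𝕂 × (ℕ → CantorC 𝕂) => s.d i c.1 :=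
        (s.measurable i).comp measurable_fst
      exact h.const_smul (TopologicalSpace.denseSeq (ℕ → 𝕂) j i)
  have h : {c : SB 𝕂 × SB 𝕂 × (ℕ → CantorC 𝕂) | (∀ n, c.2.2 n ∈ c.2.1) ∧
    ∃ k : ℕ, ∀ (n : ℕ) (a : ℕ → 𝕂),
      ‖∑ i ∈ Finset.range n, a i • c.2.2 i‖ ≤ k * ‖∑ i ∈ Finset.range n, a i • s.d i c.1‖} =
      (⋂ n, {c | c.2.2 n ∈ c.2.1}) ∩ ⋃ k : ℕ, ⋂ n : ℕ, {c | ∀ a : ℕ → 𝕂,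
      ‖∑ i ∈ Finset.range n, a i • c.2.2 i‖ ≤ k * ‖∑ i ∈ Finset.range n, a i • s.d i c.1‖} := by
    ext c
    simp
  exact (h ▸ (MeasurableSet.iInter h1).inter
    (MeasurableSet.iUnion fun k => MeasurableSet.iInter fun n => h2 k n) :
    MeasurableSet {c : SB 𝕂 × SB 𝕂 × (ℕ → CantorC 𝕂) | (∀ n, c.2.2 n ∈ c.2.1) ∧
      ∃ k : ℕ, ∀ (n : ℕ) (a : ℕ → 𝕂), ‖∑ i ∈ Finset.range n, a i • c.2.2 i‖ ≤
        k * ‖∑ i ∈ Finset.range n, a i • s.d i c.1‖}).standardBorel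

end SB

/-! ### Infinite sets of positive integers -/

section Ramsey

/-- Finitely many hereditary requirements can be met simultaneously. -/
theorem exists_infinite_forall_mem_finset {ι : Type*} (Q : ι → Set ℕ+ → Prop)
    (hanti : ∀ i L L', L' ⊆ L → Q i L → Q i L') {M : Set ℕ+}
    (h : ∀ i, ∀ L ⊆ M, L.Infinite → ∃ L' ⊆ L, L'.Infinite ∧ Q i L') (T : Finset ι)
    {L : Set ℕ+} (hLM : L ⊆ M) (hL : L.Infinite) :
    ∃ L' ⊆ L, L'.Infinite ∧ ∀ i ∈ T, Q i L' := by
  classical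
  induction T using Finset.induction_on with
  | empty => exact ⟨L, subset_rfl, hL, by simp⟩
  | insert i T _ ih =>
    obtain ⟨L₁, h₁, hi₁, hQ₁⟩ := ih
    obtain ⟨L₂, h₂, hi₂, hQ₂⟩ := h i L₁ (h₁.trans hLM) hi₁
    refine ⟨L₂, h₂.trans h₁, hi₂, fun j hj => ?_⟩
    rcases Finset.mem_insert.1 hj with rfl | hj
    · exact hQ₂
    · exact hanti _ _ _ h₂ (hQ₁ j hj)

/-- A diagonal sequence for hereditary requirements. -/
theorem exists_infinite_diagonal (Q : ℕ+ → Set ℕ+ → Prop)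
    (hanti : ∀ i L L', L' ⊆ L → Q i L → Q i L') {M : Set ℕ+} (hM : M.Infinite)
    (h : ∀ i, ∀ L ⊆ M, L.Infinite → ∃ L' ⊆ L, L'.Infinite ∧ Q i L') :
    ∃ L ⊆ M, L.Infinite ∧ ∀ v ∈ L, ∀ m ≤ v, Q m (L ∩ Set.Ioi v) := by
  have step : ∀ L : {L : Set ℕ+ // L ⊆ M ∧ L.Infinite},
      ∃ (L' : {L : Set ℕ+ // L ⊆ M ∧ L.Infinite}) (v : ℕ+), v ∈ L.1 ∧ L'.1 ⊆ L.1 ∩ Set.Ioi v ∧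
        ∀ m ≤ v, Q m L'.1 := by
    rintro ⟨L, hLM, hL⟩
    obtain ⟨v, hv⟩ := hL.nonempty
    have hL' : (L ∩ Set.Ioi v).Infinite := by
      have : L \ Set.Iic v = L ∩ Set.Ioi v := by ext; simp
      exact this ▸ hL.sdiff (Set.finite_Iic v)
    obtain ⟨L', h₁, h₂, h₃⟩ := exists_infinite_forall_mem_finset Q hanti h (Finset.Iic v)
      (Set.inter_subset_left.trans hLM) hL'
    exact ⟨⟨L', (h₁.trans Set.inter_subset_left).trans hLM, h₂⟩, v, hv, h₁,
      fun m hm => h₃ m (Finset.mem_Iic.2 hm)⟩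
  choose next v hv hnext hQ using step
  let seq : ℕ → {L : Set ℕ+ // L ⊆ M ∧ L.Infinite} := fun n =>
    Nat.rec ⟨M, subset_rfl, hM⟩ (fun _ L => next L) n
  have hseq : ∀ n, seq (n + 1) = next (seq n) := fun n => rfl
  have hmono : Antitone fun n => (seq n).1 := antitone_nat_of_succ_le fun n => by
    rw [hseq]; exact (hnext _).trans Set.inter_subset_left
  have hlt : StrictMono fun n => v (seq n) := strictMono_nat_of_lt_succ fun n => by
    have := hv (seq (n + 1))
    rw [hseq] at this
    exact (hnext _ this).2
  refine ⟨Set.range fun n => v (seq n), ?_, Set.infinite_range_of_injective hlt.injective, ?_⟩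
  · rintro _ ⟨n, rfl⟩
    exact (seq n).2.1 (hv _)
  · rintro _ ⟨n, rfl⟩ m hm
    refine hanti _ _ _ ?_ (hQ (seq n) m hm)
    rintro _ ⟨⟨k, rfl⟩, hk⟩
    have hnk : n < k := hlt.lt_iff_lt.1 hk
    rw [← hseq]
    exact hmono (Nat.succ_le_of_lt hnk) (hv (seq k))

theorem Set.Infinite.inter_Ioi {L : Set ℕ+} (hL : L.Infinite) (v : ℕ+) :
    (L ∩ Set.Ioi v).Infinite := by
  have : L \ Set.Iic v = L ∩ Set.Ioi v := by ext; simp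
  exact this ▸ hL.sdiff (Set.finite_Iic v)

/-- `E` is an initial segment of `N`. -/
def IsInitialSegment (E : Finset ℕ+) (N : Set ℕ+) : Prop :=
  (E : Set ℕ+) ⊆ N ∧ ∀ b ∈ E, ∀ a ∈ N, a < b → a ∈ E

/-- In the Galvin–Prikry terminology, `M` accepts `a`. -/
def Accepts (𝒰 : Set (Finset ℕ+)) (M : Set ℕ+) (a : Finset ℕ+) : Prop :=
  ∀ N ⊆ M, N.Infinite → (∀ x ∈ a, ∀ y ∈ N, x < y) → ∃ E ∈ 𝒰, IsInitialSegment E (a ∪ N)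

/-- In the Galvin–Prikry terminology, `M` rejects `a`. -/
def Rejects (𝒰 : Set (Finset ℕ+)) (M : Set ℕ+) (a : Finset ℕ+) : Prop :=
  ∀ N ⊆ M, N.Infinite → ¬ Accepts 𝒰 N a

variable {𝒰 : Set (Finset ℕ+)} {M : Set ℕ+}

theorem Accepts.mono {N : Set ℕ+} {a : Finset ℕ+} (h : Accepts 𝒰 M a) (hN : N ⊆ M) :
    Accepts 𝒰 N a :=
  fun N' hN' => h N' (hN'.trans hN)

theorem Rejects.mono {N : Set ℕ+} {a : Finset ℕ+} (h : Rejects 𝒰 M a) (hN : N ⊆ M) :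
    Rejects 𝒰 N a :=
  fun N' hN' => h N' (hN'.trans hN)

theorem Rejects.of_inter_Ioi {v : ℕ+} {a : Finset ℕ+}
    (h : Rejects 𝒰 (M ∩ Set.Ioi v) a) : Rejects 𝒰 M a :=
  fun N hN hi hacc => h (N ∩ Set.Ioi v) (Set.inter_subset_inter_left _ hN) (hi.inter_Ioi v)
    (hacc.mono Set.inter_subset_left)

/-- Otherwise the set of these `n` would accept `a`: an infinite subset is its least element `n`
followed by a tail, and that tail is governed by the acceptance of `insert n a`. -/
theorem Rejects.finite_setOf_accepts {a : Finset ℕ+} (h : Rejects 𝒰 M a) :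
    {n ∈ M | Accepts 𝒰 (M ∩ Set.Ioi n) (insert n a)}.Finite := by
  by_contra hinf
  refine h _ (fun n hn => hn.1) hinf fun N hN hi haN => ?_
  obtain ⟨n, hnN, hmin⟩ := WellFounded.has_min (wellFounded_lt (α := ℕ+)) N hi.nonempty
  obtain ⟨E, hE, hinit⟩ := (hN hnN).2 (N ∩ Set.Ioi n)
    (fun x hx => ⟨(hN hx.1).1, hx.2⟩) (hi.inter_Ioi n) (by
      intro x hx y hy
      rcases Finset.mem_insert.1 hx with rfl | hx
      · exact hy.2
      · exact haN x hx y hy.1)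
  refine ⟨E, hE, ?_⟩
  convert hinit using 1
  ext x
  simp only [Set.mem_union, Finset.mem_coe, Finset.mem_insert, Set.mem_inter_iff, Set.mem_Ioi]
  constructor
  · rintro (hx | hx)
    · exact Or.inl (Or.inr hx)
    · rcases (not_lt.1 (hmin x hx)).eq_or_lt with rfl | hlt
      · exact Or.inl (Or.inl rfl)
      · exact Or.inr ⟨hx, hlt⟩
  · rintro ((rfl | hx) | hx)
    · exact Or.inr hnN
    · exact Or.inl hx
    · exact Or.inr hx.1

/-- Open sets of infinite sets of positive integers are Ramsey. -/
theorem exists_infinite_open_ramsey (𝒰 : Set (Finset ℕ+)) (hM : M.Infinite) :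
    ∃ L ⊆ M, L.Infinite ∧ ((∀ E : Finset ℕ+, (E : Set ℕ+) ⊆ L → E ∉ 𝒰) ∨
      ∀ N ⊆ L, N.Infinite → ∃ E ∈ 𝒰, IsInitialSegment E N) := by
  by_cases hacc : ∃ L ⊆ M, L.Infinite ∧ Accepts 𝒰 L ∅
  · obtain ⟨L, hLM, hL, h⟩ := hacc
    refine ⟨L, hLM, hL, Or.inr fun N hN hi => ?_⟩
    simpa using h N hN hi (by simp)
  have hrej : Rejects 𝒰 M ∅ := fun L hLM hL h => hacc ⟨L, hLM, hL, h⟩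
  -- For `v ∈ L` the tail `L ∩ Ioi v` accepts or rejects each finite set bounded by `v`.
  obtain ⟨L, hLM, hL, hdec⟩ := exists_infinite_diagonal
    (fun v L => ∀ a ∈ (Finset.Iic v).powerset, Accepts 𝒰 L a ∨ Rejects 𝒰 L a)
    (fun v L L' h hQ a ha => (hQ a ha).imp (·.mono h) (·.mono h)) hM
    (fun v L hLM hL => exists_infinite_forall_mem_finset (fun a L => Accepts 𝒰 L a ∨ Rejects 𝒰 L a)
      (fun a L L' h hQ => hQ.imp (·.mono h) (·.mono h)) (M := M) (fun a L _ hL => by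
        by_cases h : Rejects 𝒰 L a
        · exact ⟨L, subset_rfl, hL, Or.inr h⟩
        · simp only [Rejects, not_forall, not_not] at h
          obtain ⟨N, hN, hi, h⟩ := h
          exact ⟨N, hN, hi, Or.inl h⟩) _ hLM hL)
  -- A second thinning makes rejection pass from `a` to `insert n a`: only finitely many `n` violate
  -- this, and they are discarded.
  obtain ⟨L₂, hL₂L, hL₂, hrej₂⟩ := exists_infinite_diagonal
    (fun v L' => ∀ a ∈ (Finset.Iic v).powerset, Rejects 𝒰 L a →
      ∀ n ∈ L', v < n → Rejects 𝒰 L (insert n a))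
    (fun v L L' h hQ a ha hr n hn => hQ a ha hr n (h hn)) hL
    (fun v L' hL'L hL' => exists_infinite_forall_mem_finset
      (fun a L' => a ∈ (Finset.Iic v).powerset → Rejects 𝒰 L a →
        ∀ n ∈ L', v < n → Rejects 𝒰 L (insert n a))
      (fun a L L' h hQ ha hr n hn => hQ ha hr n (h hn)) (M := L) (fun a L'' h'' hi'' => by
        by_cases hr : Rejects 𝒰 L a
        · refine ⟨L'' \ {n ∈ L | Accepts 𝒰 (L ∩ Set.Ioi n) (insert n a)}, Set.sdiff_subset,
            hi''.sdiff hr.finite_setOf_accepts, fun ha _ n hn hvn => ?_⟩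
          refine Rejects.of_inter_Ioi (v := n) (((hdec n (h'' hn.1) n le_rfl _ ?_)).resolve_left
            fun h => hn.2 ⟨h'' hn.1, h⟩)
          rw [Finset.mem_powerset] at ha ⊢
          intro x hx
          rw [Finset.mem_Iic]
          rcases Finset.mem_insert.1 hx with rfl | hx
          · exact le_rfl
          · exact (Finset.mem_Iic.1 (ha hx)).trans hvn.le
        · exact ⟨L'', subset_rfl, hi'', fun _ h => absurd h hr⟩) (Finset.Iic v).powerset
        hL'L hL' |>.imp fun L'' h => ⟨h.1, h.2.1, fun a ha => h.2.2 a ha ha⟩)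
  -- The spare element `v₀` plays the role of the bound for the empty set when the induction adds
  -- its first element.
  obtain ⟨v₀, hv₀⟩ := hL₂.nonempty
  refine ⟨L₂ ∩ Set.Ioi v₀, Set.inter_subset_left.trans (hL₂L.trans hLM), hL₂.inter_Ioi v₀,
    Or.inl ?_⟩
  have hall : ∀ E : Finset ℕ+, (E : Set ℕ+) ⊆ L₂ ∩ Set.Ioi v₀ → Rejects 𝒰 L E := by
    intro E
    induction E using Finset.induction_on_max with
    | empty => exact fun _ => hrej.mono hLM
    | insert n E hn ih =>
      intro hE
      rw [Finset.coe_insert, Set.insert_subset_iff] at hE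
      have hE' := ih hE.2
      obtain ⟨v, hv, hvn, hEv⟩ : ∃ v ∈ L₂, v < n ∧ ∀ x ∈ E, x ≤ v := by
        rcases E.eq_empty_or_nonempty with rfl | hne
        · exact ⟨v₀, hv₀, hE.1.2, by simp⟩
        · exact ⟨E.max' hne, (hE.2 (E.max'_mem hne)).1, hn _ (E.max'_mem hne),
            fun x hx => E.le_max' x hx⟩
      refine hrej₂ v hv v le_rfl E ?_ hE' n ⟨hE.1.1, hvn⟩ hvn
      exact Finset.mem_powerset.2 fun x hx => Finset.mem_Iic.2 (hEv x hx)
  intro E hE hU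
  -- A set `E ∈ 𝒰` is an initial segment of every `E ∪ N` with `E < N`, so `L` would accept it.
  refine hall E hE L subset_rfl hL fun N hN hi hlt => ⟨E, hU, Set.subset_union_left, ?_⟩
  rintro b hb a (ha | ha) hab
  · exact ha
  · exact absurd hab (hlt b hb a ha).not_gt

/-- Of two hereditary families, one contains the other on an infinite set. -/
theorem exists_infinite_subset_or_subset {𝓕 𝓖 : Set (Finset ℕ+)} (h𝓕 : IsLowerSet 𝓕)
    (h𝓖 : IsLowerSet 𝓖) (hM : M.Infinite) :
    ∃ L ⊆ M, L.Infinite ∧ ((∀ E : Finset ℕ+, (E : Set ℕ+) ⊆ L → E ∈ 𝓕 → E ∈ 𝓖) ∨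
      ∀ E : Finset ℕ+, (E : Set ℕ+) ⊆ L → E ∈ 𝓖 → E ∈ 𝓕) := by
  obtain ⟨L, hLM, hL, h | h⟩ := exists_infinite_open_ramsey (𝓕 \ 𝓖) hM
  · refine ⟨L, hLM, hL, Or.inl fun E hE hF => ?_⟩
    by_contra hG
    exact h E hE ⟨hF, hG⟩
  · refine ⟨L, hLM, hL, Or.inr fun E hE hG => ?_⟩
    obtain ⟨m, hm⟩ : ∃ m, ∀ x ∈ E, x ≤ m := E.bddAbove
    -- An initial segment in `𝓕 \ 𝓖` cannot lie inside `E ∈ 𝓖`, so it reaches past `E` and contains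
    -- it.
    obtain ⟨B, ⟨hBF, hBG⟩, hBsub, hBinit⟩ := h (E ∪ (L ∩ Set.Ioi m))
      (Set.union_subset hE Set.inter_subset_left)
      ((hL.inter_Ioi m).mono Set.subset_union_right)
    refine h𝓕 ?_ hBF
    have hnot : ¬ B ⊆ E := fun hsub => hBG (h𝓖 hsub hG)
    obtain ⟨b, hb, hbE⟩ := Finset.not_subset.1 hnot
    have hmb : m < b := ((hBsub hb).resolve_left hbE).2
    exact fun x hx => hBinit b hb x (Or.inl hx) ((hm x hx).trans_lt hmb)

end Ramsey

/-! ### Ranks of families of finite sets -/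

section Rank

open Ordinal

/-- Stability under spreading. -/
def IsSpreading (𝓕 : Set (Finset ℕ+)) : Prop :=
  ∀ E ∈ 𝓕, ∀ N : ℕ+ → ℕ+, StrictMono N → E.image N ∈ 𝓕

/-- The tree of the members of `𝓕`, ordered by end-extension, has rank at most `α`. -/
def RankLE (𝓕 : Set (Finset ℕ+)) (α : Ordinal.{0}) : Prop :=
  ∃ r : Finset ℕ+ → Ordinal.{0}, r ∅ ≤ α ∧
    ∀ E n, (∀ a ∈ E, a < n) → insert n E ∈ 𝓕 → r (insert n E) < r E

/-- The tree of the members of `𝓕`, ordered by end-extension, has rank at least `α`, even when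
finitely many integers are removed. -/
def RankGE (𝓕 : Set (Finset ℕ+)) (α : Ordinal.{0}) : Prop :=
  ∀ (r : Finset ℕ+ → Ordinal.{0}) (p : ℕ+) (β : Ordinal.{0}),
    (∀ E ∈ 𝓕, (∀ a ∈ E, p < a) → β ≤ r E) →
    (∀ E n, (∀ a ∈ E, p < a) → p < n → (∀ a ∈ E, a < n) → insert n E ∈ 𝓕 →
      r (insert n E) < r E) →
    β + α ≤ r ∅

/-- The sets `E₁ ∪ ⋯ ∪ Eₙ` with `E₁ < ⋯ < Eₙ` in `𝓕`. -/
def blockUnions (𝓕 : Set (Finset ℕ+)) : ℕ → Set (Finset ℕ+)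
  | 0 => {∅}
  | n + 1 => {G | ∃ E ∈ 𝓕, ∃ H ∈ blockUnions 𝓕 n, (∀ a ∈ E, ∀ b ∈ H, a < b) ∧ G = E ∪ H}

variable {𝓕 𝓖 : Set (Finset ℕ+)} {α β : Ordinal.{0}}

theorem isLowerSet_blockUnions (h : IsLowerSet 𝓕) (n : ℕ) : IsLowerSet (blockUnions 𝓕 n) := by
  classical
  induction n with
  | zero =>
    intro G G' hG' hG
    exact Finset.subset_empty.1 ((show G = ∅ from hG) ▸ hG')
  | succ n ih =>
    rintro _ G' hG' ⟨E, hE, H, hH, hlt, rfl⟩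
    refine ⟨G' ∩ E, h Finset.inter_subset_right hE, G' ∩ H, ih Finset.inter_subset_right hH,
      fun a ha b hb => hlt a (Finset.mem_inter.1 ha).2 b (Finset.mem_inter.1 hb).2, ?_⟩
    rw [← Finset.inter_union_distrib_left, Finset.inter_eq_left.2 hG']

theorem isSpreading_blockUnions (h : IsSpreading 𝓕) (n : ℕ) : IsSpreading (blockUnions 𝓕 n) := by
  classical
  induction n with
  | zero =>
    intro G hG N hN
    rw [show G = ∅ from hG]
    rfl
  | succ n ih =>
    rintro _ ⟨E, hE, H, hH, hlt, rfl⟩ N hN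
    refine ⟨E.image N, h E hE N hN, H.image N, ih H hH N hN, ?_, Finset.image_union _ _⟩
    rintro _ ha _ hb
    obtain ⟨a, haE, rfl⟩ := Finset.mem_image.1 ha
    obtain ⟨b, hbH, rfl⟩ := Finset.mem_image.1 hb
    exact hN (hlt a haE b hbH)

theorem empty_mem_blockUnions (h : ∅ ∈ 𝓕) (n : ℕ) : ∅ ∈ blockUnions 𝓕 n := by
  induction n with
  | zero => rfl
  | succ n ih => exact ⟨∅, h, ∅, ih, by simp, by simp⟩

theorem monotone_blockUnions (h : ∅ ∈ 𝓕) : Monotone (blockUnions 𝓕) :=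
  monotone_nat_of_le_succ fun _ G hG => ⟨∅, h, G, hG, by simp, by simp⟩

theorem RankLE.lt_apply_empty (h𝓖 : IsLowerSet 𝓖) {r : Finset ℕ+ → Ordinal.{0}}
    (hr : ∀ E n, (∀ a ∈ E, a < n) → insert n E ∈ 𝓖 → r (insert n E) < r E) {H : Finset ℕ+}
    (hH : H ∈ 𝓖) (hne : H.Nonempty) : r H < r ∅ := by
  induction H using Finset.induction_on_max with
  | empty => simp at hne
  | insert n E hn ih =>
    refine (hr E n hn hH).trans_le ?_
    rcases E.eq_empty_or_nonempty with rfl | hE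
    · exact le_rfl
    · exact (ih (h𝓖 (Finset.subset_insert n E) hH) hE).le

/-- While `X` stays in `𝓕` its rank there, shifted by `β`, counts down. Outside `𝓕` the rank of `X`
is the largest `𝓖`-rank of a tail `H` with `X \ H ∈ 𝓕`. It decreases because a tail of `insert n X`
is a tail of `X` with `n` added. -/
theorem RankLE.union (h𝓕 : IsLowerSet 𝓕) (h𝓖 : IsLowerSet 𝓖) (hα : RankLE 𝓕 α)
    (hβ : RankLE 𝓖 β) :
    RankLE {G | ∃ E ∈ 𝓕, ∃ H ∈ 𝓖, (∀ a ∈ E, ∀ b ∈ H, a < b) ∧ G = E ∪ H} (β + α) := by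
  classical
  obtain ⟨r, hr0, hr⟩ := hα
  obtain ⟨t, ht0, ht⟩ := hβ
  let tails : Finset ℕ+ → Finset (Finset ℕ+) := fun X => X.powerset.filter fun H =>
    H.Nonempty ∧ X \ H ∈ 𝓕 ∧ (∀ a ∈ X \ H, ∀ b ∈ H, a < b) ∧ H ∈ 𝓖
  have htails : ∀ X ∈ {G | ∃ E ∈ 𝓕, ∃ H ∈ 𝓖, (∀ a ∈ E, ∀ b ∈ H, a < b) ∧ G = E ∪ H},
      X ∉ 𝓕 → (tails X).Nonempty := by
    rintro _ ⟨E, hE, H, hH, hlt, rfl⟩ hX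
    have hdisj : Disjoint E H :=
      Finset.disjoint_left.2 fun a ha hb => (hlt a ha a hb).false
    have hsd : (E ∪ H) \ H = E := by
      rw [Finset.union_sdiff_right, Finset.sdiff_eq_self_of_disjoint hdisj]
    refine ⟨H, Finset.mem_filter.2 ⟨Finset.mem_powerset.2 Finset.subset_union_right, ?_, ?_, ?_,
      hH⟩⟩
    · rw [Finset.nonempty_iff_ne_empty]
      rintro rfl
      exact hX (by simpa using hE)
    · rwa [hsd]
    · rwa [hsd]
  have htail_lt : ∀ X H, H ∈ tails X → t H < t ∅ := by
    intro X H hH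
    obtain ⟨-, hne, -, -, hH⟩ := Finset.mem_filter.1 hH
    exact RankLE.lt_apply_empty h𝓖 ht hH hne
  refine ⟨fun X => if X ∈ 𝓕 then β + r X else (tails X).sup t, ?_, ?_⟩
  · beta_reduce
    split_ifs
    · gcongr
    · refine Finset.sup_le fun H hH => ?_
      have := (Finset.mem_powerset.1 (Finset.mem_filter.1 hH).1)
      exact absurd (Finset.mem_filter.1 hH).2.1 (by simp [Finset.subset_empty.1 this])
  · intro X n hn hX
    by_cases h1 : insert n X ∈ 𝓕
    · have h2 : X ∈ 𝓕 := h𝓕 (Finset.subset_insert n X) h1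
      simp only [h1, h2, if_true]
      gcongr
      exact hr X n hn h1
    have hne := htails _ hX h1
    simp only [h1, if_false]
    by_cases h2 : X ∈ 𝓕
    · simp only [h2, if_true]
      have hlt : ∀ H ∈ tails (insert n X), t H < β + r X := fun H hH =>
        ((htail_lt _ H hH).trans_le ht0).trans_le le_self_add
      obtain ⟨H, hH⟩ := hne
      exact (Finset.sup_lt_iff ((zero_le.trans_lt (hlt H hH) : (⊥ : Ordinal) < _))).2 hlt
    · simp only [h2, if_false]
      have hlt : ∀ H ∈ tails (insert n X), t H < (tails X).sup t := by
        intro H hH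
        obtain ⟨hsub, hHne, hsd, hlt, hH⟩ := Finset.mem_filter.1 hH
        rw [Finset.mem_powerset] at hsub
        have hnX : n ∉ X := fun h => (hn n h).false
        have hnH : n ∈ H := by
          by_contra hnH
          obtain ⟨b, hb⟩ := hHne
          have h3 := hlt n (Finset.mem_sdiff.2 ⟨Finset.mem_insert_self n X, hnH⟩) b hb
          rcases Finset.mem_insert.1 (hsub hb) with rfl | h
          · exact h3.false
          · exact (h3.trans (hn b h)).false
        have hsd' : X \ H.erase n = insert n X \ H := by
          ext x
          simp only [Finset.mem_sdiff, Finset.mem_erase, Finset.mem_insert]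
          constructor
          · rintro ⟨hx, hxH⟩
            exact ⟨Or.inr hx, fun h => hxH ⟨fun h' => hnX (h' ▸ hx), h⟩⟩
          · rintro ⟨rfl | hx, hxH⟩
            · exact absurd hnH hxH
            · exact ⟨hx, fun h => hxH h.2⟩
        have hmem : H.erase n ∈ tails X := by
          refine Finset.mem_filter.2 ⟨?_, ?_, ?_, ?_, h𝓖 (Finset.erase_subset n H) hH⟩
          · rw [Finset.mem_powerset]
            intro x hx
            rw [Finset.mem_erase] at hx
            exact (Finset.mem_insert.1 (hsub hx.2)).resolve_left hx.1
          · rw [Finset.nonempty_iff_ne_empty]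
            intro h
            rw [h, Finset.sdiff_empty] at hsd'
            exact h2 (hsd' ▸ hsd)
          · rwa [hsd']
          · rw [hsd']
            exact fun a ha b hb => hlt a ha b (Finset.mem_of_mem_erase hb)
        refine lt_of_lt_of_le ?_ (Finset.le_sup (f := t) hmem)
        have h4 := ht (H.erase n) n (fun a ha => by
          rw [Finset.mem_erase] at ha
          exact hn a ((Finset.mem_insert.1 (hsub ha.2)).resolve_left ha.1))
        rw [Finset.insert_erase hnH] at h4
        exact h4 hH
      obtain ⟨H, hH⟩ := hne
      exact (Finset.sup_lt_iff ((zero_le.trans_lt (hlt H hH) : (⊥ : Ordinal) < _))).2 hlt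

theorem RankLE.blockUnions (h𝓕 : IsLowerSet 𝓕) (hα : RankLE 𝓕 α) (n : ℕ) :
    RankLE (blockUnions 𝓕 n) (α * n) := by
  induction n with
  | zero =>
    refine ⟨fun _ => 0, by simp, fun E n _ h => ?_⟩
    exact absurd (show insert n E = ∅ from h) (Finset.insert_ne_empty n E)
  | succ n ih =>
    rw [Nat.cast_succ, mul_add_one]
    exact RankLE.union h𝓕 (isLowerSet_blockUnions h𝓕 n) hα ih

/-- With the first block `E` fixed, induction applied to `H ↦ r (E ∪ H)` for `H` beyond `E` bounds
`r E` from below; this bound then serves as the base value for the rank of `𝓕`. Starting beyond `E`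
is possible because `RankGE` allows the removal of finitely many integers. -/
theorem RankGE.blockUnions (h0 : ∅ ∈ 𝓕) (hα : RankGE 𝓕 α) (n : ℕ) :
    RankGE (blockUnions 𝓕 n) (α * n) := by
  classical
  induction n with
  | zero =>
    intro r p β hβ _
    simpa using hβ ∅ rfl (by simp)
  | succ n ih =>
    intro r p β hβ hr
    rw [Nat.cast_succ, mul_add_one, ← add_assoc]
    refine hα r p _ (fun E hE hpE => ?_) fun E m hpE hpm hEm hins => ?_
    · obtain ⟨q, hq⟩ : ∃ q, ∀ x ∈ insert p E, x ≤ q := (insert p E).bddAbove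
      have hpq : p ≤ q := hq p (Finset.mem_insert_self p E)
      have hEq : ∀ a ∈ E, a ≤ q := fun a ha => hq a (Finset.mem_insert_of_mem ha)
      have := ih (fun H => r (E ∪ H)) q β (fun H hH hqH => ?_) fun H m hqH hqm hHm hins => ?_
      · simpa using this
      · refine hβ _ ⟨E, hE, H, hH, fun a ha b hb => (hEq a ha).trans_lt (hqH b hb), rfl⟩ ?_
        intro a ha
        rcases Finset.mem_union.1 ha with ha | ha
        · exact hpE a ha
        · exact hpq.trans_lt (hqH a ha)
      · rw [Finset.union_insert]
        refine hr (E ∪ H) m ?_ (hpq.trans_lt hqm) ?_ ?_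
        · intro a ha
          rcases Finset.mem_union.1 ha with ha | ha
          · exact hpE a ha
          · exact hpq.trans_lt (hqH a ha)
        · intro a ha
          rcases Finset.mem_union.1 ha with ha | ha
          · exact (hEq a ha).trans_lt hqm
          · exact hHm a ha
        · refine ⟨E, hE, _, hins, ?_, (Finset.union_insert _ _ _).symm⟩
          intro a ha b hb
          rcases Finset.mem_insert.1 hb with rfl | hb
          · exact (hEq a ha).trans_lt hqm
          · exact (hEq a ha).trans_lt (hqH b hb)
    · exact hr E m hpE hpm hEm ⟨_, hins, ∅, empty_mem_blockUnions h0 n, by simp, by simp⟩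

end Rank

/-! ### Schreier families -/

section Schreier

open Ordinal

/-- A sequence of families `𝓖 n` that generates the Schreier family `𝓕` of order `ξ`. -/
structure IsSchreierApprox (ξ : Ordinal.{0}) (𝓕 : Set (Finset ℕ+)) (𝓖 : ℕ+ → Set (Finset ℕ+)) :
    Prop where
  isLowerSet : ∀ n, IsLowerSet (𝓖 n)
  isSpreading : ∀ n, IsSpreading (𝓖 n)
  empty_mem : ∀ n, ∅ ∈ 𝓖 n
  monotone : Monotone 𝓖
  eq : 𝓕 = {G | ∃ n : ℕ+, (∀ a ∈ G, n ≤ a) ∧ G ∈ 𝓖 n}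
  rankLE : ∀ n, ∃ α < ω ^ ξ, RankLE (𝓖 n) α
  rankGE : ∀ γ < ω ^ ξ, ∃ n, ∃ α ≥ γ, RankGE (𝓖 n) α

/-- The properties of the Schreier family of order `ξ` that are used. -/
structure IsSchreierFamily (ξ : Ordinal.{0}) (𝓕 : Set (Finset ℕ+)) : Prop where
  isLowerSet : IsLowerSet 𝓕
  isSpreading : IsSpreading 𝓕
  empty_mem : ∅ ∈ 𝓕
  rankLE : RankLE 𝓕 (ω ^ ξ)
  rankGE : RankGE 𝓕 (ω ^ ξ)

theorem PNat.le_apply_of_strictMono {N : ℕ+ → ℕ+} (hN : StrictMono N) (n : ℕ+) : n ≤ N n :=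
  hN.le_apply

/-- Once the minimum `m` of a set is known, its extensions in `𝓕` lie in `𝓖 m`, of rank below `ω ^
ξ`; this gives the upper bound. Beyond `n` the family contains `𝓖 n`, and these ranks are cofinal in
the limit ordinal `ω ^ ξ`; this gives the lower one. -/
theorem IsSchreierApprox.isSchreierFamily {ξ : Ordinal.{0}} (hξ : ξ ≠ 0) {𝓕 : Set (Finset ℕ+)}
    {𝓖 : ℕ+ → Set (Finset ℕ+)} (h : IsSchreierApprox ξ 𝓕 𝓖) : IsSchreierFamily ξ 𝓕 := by
  classical
  obtain ⟨hlow, hspr, h0, hmono, rfl, hle, hge⟩ := h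
  refine ⟨?_, ?_, ⟨1, by simp, h0 1⟩, ?_, ?_⟩
  · rintro G G' hG' ⟨n, hn, hG⟩
    exact ⟨n, fun a ha => hn a (hG' ha), hlow n hG' hG⟩
  · rintro G ⟨n, hn, hG⟩ N hN
    refine ⟨n, fun x ha => ?_, hspr n G hG N hN⟩
    obtain ⟨a, haE, rfl⟩ := Finset.mem_image.1 ha
    exact (hn a haE).trans (PNat.le_apply_of_strictMono hN a)
  · choose α hα r hr0 hr using hle
    refine ⟨fun E => if hE : E.Nonempty then r (E.min' hE) E else ω ^ ξ, by simp, ?_⟩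
    rintro E n hn ⟨m, hm, hE⟩
    beta_reduce
    rw [dif_pos (Finset.insert_nonempty n E)]
    rcases E.eq_empty_or_nonempty with rfl | hne
    · rw [dif_neg Finset.not_nonempty_empty]
      have hmn : m ≤ n := hm n (Finset.mem_insert_self n ∅)
      refine lt_of_lt_of_le ?_ (hα n).le
      refine lt_of_lt_of_le ?_ (hr0 n)
      have : (insert n (∅ : Finset ℕ+)).min' (Finset.insert_nonempty n ∅) = n := by simp
      rw [this]
      exact hr n ∅ n hn (hmono hmn hE)
    · rw [dif_pos hne]
      have : (insert n E).min' (Finset.insert_nonempty n E) = E.min' hne := by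
        rw [Finset.min'_insert n E hne]
        exact min_eq_right (hn _ (E.min'_mem hne)).le
      rw [this]
      exact hr _ E n hn (hmono (hm _ (Finset.mem_insert_of_mem (E.min'_mem hne))) hE)
  · intro r p β hβ hr
    have hlim : Order.IsSuccLimit (ω ^ ξ) := isSuccLimit_opow_left isSuccLimit_omega0 hξ
    rw [add_le_iff_of_isSuccLimit hlim]
    intro γ hγ
    obtain ⟨n, α, hα, hR⟩ := hge γ hγ
    refine (add_le_add_right hα β).trans (hR r (max p n) β (fun E hE hpE => ?_) ?_)
    · exact hβ E ⟨n, fun a ha => ((le_max_right p n).trans_lt (hpE a ha)).le, hE⟩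
        fun a ha => (le_max_left p n).trans_lt (hpE a ha)
    · intro E m hpE hpm hEm hins
      refine hr E m (fun a ha => (le_max_left p n).trans_lt (hpE a ha))
        ((le_max_left p n).trans_lt hpm) hEm ⟨n, ?_, hins⟩
      intro a ha
      rcases Finset.mem_insert.1 ha with rfl | ha
      · exact ((le_max_right p n).trans_lt hpm).le
      · exact ((le_max_right p n).trans_lt (hpE a ha)).le

theorem isSchreierFamily_zero : IsSchreierFamily 0 {G | G.card ≤ 1} := by
  classical
  refine ⟨fun G G' h hG => (Finset.card_le_card h).trans hG,
    fun G hG N hN => Finset.card_image_le.trans hG, by simp, ?_, ?_⟩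
  · refine ⟨fun E => if E = ∅ then 1 else 0, by simp, fun E n hn h => ?_⟩
    have hnE : n ∉ E := fun h => (hn n h).false
    have hE : E = ∅ := by
      rw [Set.mem_ofPred_eq, Finset.card_insert_of_notMem hnE] at h
      exact Finset.card_eq_zero.1 (by omega)
    simp [hE]
  · intro r p β hβ hr
    rw [opow_zero]
    have h1 := hr ∅ (p + 1) (by simp) (PNat.lt_add_right p 1) (by simp) (by simp)
    have h2 := hβ (insert (p + 1) ∅) (by simp) (by simp)
    rw [← Order.succ_eq_add_one]
    exact Order.succ_le_of_lt (h2.trans_lt h1)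

/-- Unions of successive nonempty members of a family, indexed by `Fin n`. -/
theorem mem_blockUnions_iff {𝓕 : Set (Finset ℕ+)} (h0 : ∅ ∈ 𝓕) {G : Finset ℕ+} {n : ℕ} :
    G ∈ blockUnions 𝓕 n ↔ ∃ k ≤ n, ∃ H : Fin k → Finset ℕ+, (∀ i, (H i).Nonempty ∧ H i ∈ 𝓕) ∧
      (∀ i j, i < j → ∀ a ∈ H i, ∀ b ∈ H j, a < b) ∧ G = Finset.univ.biUnion H := by
  classical
  constructor
  · induction n generalizing G with
    | zero =>
      rintro (rfl : G = ∅)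
      exact ⟨0, le_rfl, Fin.elim0, fun i => i.elim0, fun i => i.elim0, by simp⟩
    | succ n ih =>
      rintro ⟨E, hE, G, hG, hlt, rfl⟩
      obtain ⟨k, hk, H, hH, hHlt, rfl⟩ := ih hG
      rcases E.eq_empty_or_nonempty with rfl | hne
      · exact ⟨k, hk.trans n.le_succ, H, hH, hHlt, by simp⟩
      · refine ⟨k + 1, Nat.succ_le_succ hk, Fin.cons E H, ?_, ?_, ?_⟩
        · refine Fin.cases ⟨hne, hE⟩ fun i => by simpa using hH i
        · refine Fin.cases ?_ fun i => ?_
          · refine Fin.cases (fun h => absurd h (lt_irrefl _)) fun j _ a ha b hb => ?_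
            exact hlt a ha b (Finset.mem_biUnion.2 ⟨j, Finset.mem_univ j, hb⟩)
          · refine Fin.cases (fun h => absurd h (Fin.not_lt_zero _)) fun j hij a ha b hb => ?_
            exact hHlt i j (Fin.succ_lt_succ_iff.1 hij) a ha b hb
        · ext x
          simp [Fin.exists_fin_succ]
  · rintro ⟨k, hk, H, hH, hHlt, rfl⟩
    refine monotone_blockUnions h0 hk ?_
    clear hk
    induction k with
    | zero => simp [blockUnions]
    | succ k ih =>
      refine ⟨H 0, (hH 0).2, _, ih (fun i => H i.succ) (fun i => hH _)
        (fun i j hij => hHlt _ _ (Fin.succ_lt_succ_iff.2 hij)), ?_, ?_⟩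
      · intro a ha b hb
        obtain ⟨j, -, hb⟩ := Finset.mem_biUnion.1 hb
        exact hHlt 0 j.succ (Fin.succ_pos j) a ha b hb
      · ext x
        simp [Fin.exists_fin_succ]

variable {S : Ordinal.{0} → Set (Finset ℕ+)}

theorem IsSchreierSystem.succ_eq (hS : IsSchreierSystem S) {ξ : Ordinal.{0}}
    (hξ : ξ < Ordinal.omega 1) (h0 : ∅ ∈ S ξ) :
    S (ξ + 1) = {G | ∃ n : ℕ+, (∀ a ∈ G, n ≤ a) ∧ G ∈ blockUnions (S ξ) n} := by
  classical
  rw [hS.succ ξ hξ]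
  ext G
  constructor
  · rintro (rfl | ⟨n, H, hH, hn, hlt, rfl⟩)
    · exact ⟨1, by simp, empty_mem_blockUnions h0 _⟩
    · rcases Nat.eq_zero_or_pos n with rfl | hpos
      · exact ⟨1, by simp, by simpa using empty_mem_blockUnions h0 _⟩
      · refine ⟨⟨n, hpos⟩, fun a ha => ?_, (mem_blockUnions_iff h0).2 ⟨n, le_rfl, H, hH, hlt, rfl⟩⟩
        obtain ⟨i, -, ha⟩ := Finset.mem_biUnion.1 ha
        exact hn i a ha
  · rintro ⟨n, hn, hG⟩
    obtain ⟨k, hk, H, hH, hlt, rfl⟩ := (mem_blockUnions_iff h0).1 hG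
    refine Or.inr ⟨k, H, hH, fun i a ha => hk.trans ?_, hlt, rfl⟩
    exact hn a (Finset.mem_biUnion.2 ⟨i, Finset.mem_univ i, ha⟩)

/-- The approximations are the unions of `n` blocks, whose ranks `ω ^ ξ * n` have supremum `ω ^ (ξ +
1)`. -/
theorem IsSchreierSystem.exists_approx_succ (hS : IsSchreierSystem S) {ξ : Ordinal.{0}}
    (hξ : ξ < Ordinal.omega 1) (h : IsSchreierFamily ξ (S ξ)) :
    ∃ 𝓖, IsSchreierApprox (ξ + 1) (S (ξ + 1)) 𝓖 := by
  refine ⟨fun n => blockUnions (S ξ) n, fun n => isLowerSet_blockUnions h.isLowerSet n,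
    fun n => isSpreading_blockUnions h.isSpreading n, fun n => empty_mem_blockUnions h.empty_mem n,
    fun m n hmn => monotone_blockUnions h.empty_mem hmn, hS.succ_eq hξ h.empty_mem, fun n => ?_,
    fun γ hγ => ?_⟩
  · refine ⟨_, ?_, h.rankLE.blockUnions h.isLowerSet n⟩
    rw [opow_add_one]
    gcongr
    · exact opow_pos _ omega0_pos
    · exact natCast_lt_omega0 n
  · rw [opow_add_one, lt_mul_iff_of_isSuccLimit isSuccLimit_omega0] at hγ
    obtain ⟨c, hc, hγ⟩ := hγ
    obtain ⟨n, rfl⟩ := lt_omega0.1 hc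
    refine ⟨n.succPNat, _, ?_, h.rankGE.blockUnions h.empty_mem _⟩
    refine hγ.le.trans ?_
    gcongr
    simp

theorem IsSchreierSystem.isSchreierFamily (hS : IsSchreierSystem S) (ξ : Ordinal.{0})
    (hξ : ξ < Ordinal.omega 1) :
    IsSchreierFamily ξ (S ξ) ∧ (ξ ≠ 0 → ∃ 𝓖, IsSchreierApprox ξ (S ξ) 𝓖) := by
  induction ξ using WellFoundedLT.induction with
  | ind ξ ih =>
  rcases zero_or_succ_or_isSuccLimit ξ with rfl | ⟨ζ, rfl⟩ | hlim
  · refine ⟨?_, fun h => absurd rfl h⟩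
    rw [hS.zero]
    exact isSchreierFamily_zero
  · rw [Order.succ_eq_add_one] at *
    have hζ : ζ < ζ + 1 := lt_add_one ζ
    obtain ⟨𝓖, h𝓖⟩ := hS.exists_approx_succ (hζ.trans hξ) (ih ζ hζ (hζ.trans hξ)).1
    exact ⟨h𝓖.isSchreierFamily (by simp), fun _ => ⟨𝓖, h𝓖⟩⟩
  · obtain ⟨ζ, -, hζ, hcof, hsub, heq⟩ := hS.limit ξ hξ hlim
    have hζ1 : ∀ n, ζ n + 1 < ξ := fun n => by
      rw [← Order.succ_eq_add_one]
      exact hlim.succ_lt (hζ n)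
    have hfam : ∀ n, IsSchreierFamily (ζ n + 1) (S (ζ n + 1)) := fun n =>
      (ih _ (hζ1 n) ((hζ1 n).trans hξ)).1
    have hfam' : ∀ n, IsSchreierFamily (ζ n) (S (ζ n)) := fun n =>
      (ih _ (hζ n) ((hζ n).trans hξ)).1
    have happ : IsSchreierApprox ξ (S ξ) fun n => S (ζ n + 1) := by
      refine ⟨fun n => (hfam n).isLowerSet, fun n => (hfam n).isSpreading,
        fun n => (hfam n).empty_mem, ?_, heq, fun n => ?_, fun γ hγ => ?_⟩
      -- The assumed inclusion ends in `S (ζ (n + 1))`; a single block leads on to the successor.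
      · have hstep : ∀ n, S (ζ n + 1) ⊆ S (ζ (n + 1) + 1) := by
          intro n G hG
          rw [hS.succ_eq ((hζ _).trans hξ) (hfam' _).empty_mem]
          exact ⟨1, by simp, G, hsub n hG, ∅, rfl, by simp, by simp⟩
        intro m n hmn
        induction n using PNat.recOn with
        | one => rw [le_antisymm hmn (one_le)]
        | succ n ihn =>
          rcases hmn.lt_or_eq with h | rfl
          · exact (ihn (PNat.lt_add_one_iff.1 h)).trans (hstep n)
          · exact le_rfl
      · exact ⟨_, (opow_lt_opow_iff_right one_lt_omega0).2 (hζ1 n), (hfam n).rankLE⟩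
      · rw [lt_opow_of_isSuccLimit omega0_ne_zero hlim] at hγ
        obtain ⟨η, hη, hγ⟩ := hγ
        obtain ⟨n, hn⟩ := hcof η hη
        refine ⟨n, _, hγ.le.trans ?_, (hfam n).rankGE⟩
        exact opow_le_opow_right omega0_pos (hn.le.trans (lt_add_one _).le)
    exact ⟨happ.isSchreierFamily hlim.ne_bot, fun _ => ⟨_, happ⟩⟩

/-- No infinite set spreads the tail of a Schreier family into one of its approximations. -/
theorem IsSchreierApprox.not_forall_image_mem {ξ : Ordinal.{0}} (hξ : ξ ≠ 0)
    {𝓕 : Set (Finset ℕ+)} {𝓖 : ℕ+ → Set (Finset ℕ+)} (h : IsSchreierApprox ξ 𝓕 𝓖)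
    {N : ℕ+ → ℕ+} (hN : StrictMono N) (n p : ℕ+) :
    ¬ ∀ G ∈ 𝓕, (∀ a ∈ G, p < a) → G.image N ∈ 𝓖 n := by
  classical
  intro hsub
  obtain ⟨α, hα, r, hr0, hr⟩ := h.rankLE n
  -- The rank function of `𝓖 n`, pulled back along `N`, would give the tail of `𝓕` a rank below `ω ^
  -- ξ`.
  have := (h.isSchreierFamily hξ).rankGE (fun E => r (E.image N)) p 0 (fun _ _ _ => zero_le)
    fun E m hE hpm hEm hins => ?_
  · rw [zero_add, Finset.image_empty] at this
    exact (this.trans hr0).not_gt hα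
  · have h1 := hsub _ hins (by
      intro a ha
      rcases Finset.mem_insert.1 ha with rfl | ha
      · exact hpm
      · exact hE a ha)
    rw [Finset.image_insert] at h1 ⊢
    refine hr _ _ ?_ h1
    rintro _ ha
    obtain ⟨a, haE, rfl⟩ := Finset.mem_image.1 ha
    exact hN (hEm a haE)

end Schreier

/-! ### Sequences indexed by the positive integers -/

theorem Set.Infinite.exists_strictMono_mem {M : Set ℕ+} (hM : M.Infinite) :
    ∃ L : ℕ+ → ℕ+, StrictMono L ∧ ∀ i, L i ∈ M := by
  have h : ∃ᶠ n in atTop, Nat.succPNat n ∈ M := by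
    rw [frequently_atTop]
    intro a
    obtain ⟨x, hxM, hx⟩ := (hM.inter_Ioi a.succPNat).nonempty
    refine ⟨x.natPred, ?_, by rwa [PNat.succPNat_natPred]⟩
    have := PNat.natPred_strictMono hx
    simpa using this.le
  obtain ⟨φ, hφ, hM⟩ := extraction_of_frequently_atTop h
  exact ⟨fun i => (φ i.natPred).succPNat,
    Nat.succPNat_strictMono.comp (hφ.comp PNat.natPred_strictMono), fun i => hM _⟩

theorem exists_strictMono_of_not_tendsto {E : Type*} [NormedAddCommGroup E] {x : ℕ+ → E}
    (h : ¬ Tendsto x atTop (𝓝 0)) :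
    ∃ (δ : ℝ) (L : ℕ+ → ℕ+), 0 < δ ∧ StrictMono L ∧ ∀ i, δ ≤ ‖x (L i)‖ := by
  rw [Metric.tendsto_atTop] at h
  push Not at h
  obtain ⟨δ, hδ, h⟩ := h
  have hinf : {n | δ ≤ ‖x n‖}.Infinite := Set.infinite_of_forall_exists_gt fun a => by
    obtain ⟨n, hn, hx⟩ := h (a + 1)
    exact ⟨n, by simpa using hx, (PNat.lt_add_right a 1).trans_le hn⟩
  obtain ⟨L, hL, hLM⟩ := hinf.exists_strictMono_mem
  exact ⟨δ, L, hδ, hL, hLM⟩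

section Large

variable {𝕂 : Type} [RCLike 𝕂] {E : Type} [NormedAddCommGroup E] [NormedSpace 𝕂 E]

theorem isLowerSet_largeSets (ε : ℝ) (x : ℕ+ → E) : IsLowerSet (largeSets 𝕂 ε x) := by
  rintro G G' hG ⟨f, hf, h⟩
  exact ⟨f, hf, fun n hn => h n (hG hn)⟩

theorem mem_largeSets_of_norm_sub_le {ε ε' : ℝ} {x x' : ℕ+ → E} {G : Finset ℕ+}
    (hG : G ∈ largeSets 𝕂 ε x) (h : ∀ n ∈ G, ‖x n - x' n‖ ≤ ε - ε') : G ∈ largeSets 𝕂 ε' x' := by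
  obtain ⟨f, hf, hfG⟩ := hG
  refine ⟨f, hf, fun n hn => ?_⟩
  have h1 : ‖f (x n) - f (x' n)‖ ≤ ε - ε' := by
    rw [← map_sub]
    refine (f.le_of_opNorm_le hf _).trans ?_
    rw [one_mul]
    exact h n hn
  have h2 := norm_sub_norm_le (f (x n)) (f (x' n))
  linarith [hfG n hn]

theorem mem_largeSets_of_le {ε ε' : ℝ} {x : ℕ+ → E} {G : Finset ℕ+}
    (hG : G ∈ largeSets 𝕂 ε x) (h : ε' ≤ ε) : G ∈ largeSets 𝕂 ε' x :=
  mem_largeSets_of_norm_sub_le hG fun n _ => by simpa using h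

theorem image_mem_largeSets_iff {ε : ℝ} {x : ℕ+ → E} {G : Finset ℕ+} {L : ℕ+ → ℕ+} :
    G.image L ∈ largeSets 𝕂 ε x ↔ G ∈ largeSets 𝕂 ε (x ∘ L) := by
  simp [largeSets]

variable {𝓕 : Set (Finset ℕ+)}

theorem IsFamilyWeaklyNull.comp {x : ℕ+ → E} (h : IsFamilyWeaklyNull 𝕂 𝓕 x) {L : ℕ+ → ℕ+}
    (hL : StrictMono L) : IsFamilyWeaklyNull 𝕂 𝓕 (x ∘ L) := by
  rintro ⟨ε, N, hε, hN, hG⟩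
  refine h ⟨ε, L ∘ N, hε, hL.comp hN, fun G hG' => ?_⟩
  rw [← Finset.image_image, image_mem_largeSets_iff]
  exact hG G hG'

/-- Shifting past the indices with `1 / i ≥ ε / 2` costs half of `ε`, and spreading keeps the
shifted sets in `𝓕`. -/
theorem IsFamilyWeaklyNull.of_norm_sub_le (h𝓕 : IsSpreading 𝓕) {x x' : ℕ+ → E}
    (h : IsFamilyWeaklyNull 𝕂 𝓕 x) (hx : ∀ i, ‖x i - x' i‖ ≤ 1 / (i : ℝ)) :
    IsFamilyWeaklyNull 𝕂 𝓕 x' := by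
  rintro ⟨ε, N, hε, hN, hG⟩
  obtain ⟨p, hp⟩ := exists_nat_one_div_lt (half_pos hε)
  have hadd : StrictMono fun i : ℕ+ => i + p.succPNat := fun i j hij => by
    exact add_lt_add_left hij _
  refine h ⟨ε / 2, fun i => N (i + p.succPNat), half_pos hε, hN.comp hadd, fun G hGF => ?_⟩
  have h1 := hG _ (h𝓕 G hGF _ hadd)
  rw [Finset.image_image] at h1
  refine mem_largeSets_of_norm_sub_le h1 fun n hn => ?_
  obtain ⟨i, -, rfl⟩ := Finset.mem_image.1 hn
  rw [norm_sub_rev]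
  refine (hx _).trans ?_
  have h2 : ((p : ℝ) + 1) ≤ (N (i + p.succPNat) : ℕ+) := by
    have h3 : p.succPNat ≤ N (i + p.succPNat) :=
      (PNat.lt_add_left _ _).le.trans (hN.le_apply)
    have h4 : (p + 1 : ℕ) ≤ (N (i + p.succPNat) : ℕ) := h3
    exact_mod_cast h4
  have h5 : 1 / ((N (i + p.succPNat) : ℕ+) : ℝ) ≤ 1 / ((p : ℝ) + 1) :=
    one_div_le_one_div_of_le (by positivity) h2
  exact h5.trans (by linarith)

/-- The Banach–Alaoglu theorem for sequences of conditions. -/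
theorem exists_forall_le_norm_of_forall_mem_largeSets {ε : ℝ} {x : ℕ+ → E}
    (h : ∀ G, G ∈ largeSets 𝕂 ε x) : ∃ f : StrongDual 𝕂 E, ‖f‖ ≤ 1 ∧ ∀ n, ε ≤ ‖f (x n)‖ := by
  let B : Set (WeakDual 𝕂 E) := WeakDual.toStrongDual ⁻¹' Metric.closedBall 0 1
  have hB : IsCompact B := WeakDual.isCompact_closedBall 0 1
  obtain ⟨f, hfB, hf⟩ := hB.inter_iInter_nonempty (fun n : ℕ+ => {f | ε ≤ ‖f (x n)‖})
    (fun n => isClosed_le continuous_const (WeakDual.eval_continuous (x n)).norm) fun G => by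
      obtain ⟨f, hf, hfG⟩ := h G
      refine ⟨WeakDual.toStrongDual.symm f, ?_, ?_⟩
      · simpa [B] using hf
      · simpa using hfG
  refine ⟨WeakDual.toStrongDual f, by simpa [B] using hfB, fun n => ?_⟩
  exact Set.mem_iInter.1 hf n

/-- If all finite parts of a subsequence are large, compactness provides one functional for the
whole subsequence. Complete continuity thus becomes an instance of the family version. -/
theorem isFamilyWeaklyNull_univ_iff {x : ℕ+ → E} :
    IsFamilyWeaklyNull 𝕂 Set.univ x ↔ ∀ f : StrongDual 𝕂 E, Tendsto (fun n => f (x n)) atTop (𝓝 0) := by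
  constructor
  · intro h f
    by_contra hf
    obtain ⟨δ, L, hδ, hL, hLf⟩ := exists_strictMono_of_not_tendsto hf
    have hpos : 0 < ‖f‖ + 1 := by positivity
    refine h ⟨δ / (‖f‖ + 1), L, by positivity, hL, fun G _ => ⟨((‖f‖ + 1 : ℝ) : 𝕂)⁻¹ • f, ?_, ?_⟩⟩
    · rw [norm_smul, norm_inv, RCLike.norm_ofReal, abs_of_pos hpos, inv_mul_le_iff₀ hpos]
      linarith
    · intro n hn
      obtain ⟨i, -, rfl⟩ := Finset.mem_image.1 hn
      rw [smul_apply, norm_smul, norm_inv, RCLike.norm_ofReal,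
        abs_of_pos hpos, div_eq_inv_mul]
      gcongr
      exact hLf i
  · rintro h ⟨ε, N, hε, hN, hG⟩
    obtain ⟨f, -, hf⟩ := exists_forall_le_norm_of_forall_mem_largeSets (𝕂 := 𝕂) (x := x ∘ N)
      fun G => image_mem_largeSets_iff.1 (hG G trivial)
    have hN' : Tendsto N atTop atTop :=
      tendsto_atTop_mono (fun i => hN.le_apply) tendsto_id
    have := ((h f).comp hN').norm
    rw [norm_zero] at this
    exact (ge_of_tendsto' this hf).not_gt hε

theorem tendsto_atTop_pnat_iff {X : Type*} {l : Filter X} {x : ℕ+ → X} :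
    Tendsto x atTop l ↔ Tendsto (fun n => x (Nat.succPNat n)) atTop l := by
  constructor
  · exact fun h => h.comp OrderIso.pnatIsoNat.symm.tendsto_atTop
  · intro h
    have := h.comp OrderIso.pnatIsoNat.tendsto_atTop
    refine this.congr fun i => ?_
    simp

theorem isCompletelyContinuous_iff {F : Type} [NormedAddCommGroup F] [NormedSpace 𝕂 F]
    {A : E →L[𝕂] F} : IsCompletelyContinuous A ↔ IsFamilyCompletelyContinuous Set.univ A := by
  constructor
  · intro h x hx
    rw [tendsto_atTop_pnat_iff]
    refine h _ fun f => ?_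
    exact tendsto_atTop_pnat_iff.1 (isFamilyWeaklyNull_univ_iff.1 hx f)
  · intro h x hx
    have := h (fun i => x i.natPred) (isFamilyWeaklyNull_univ_iff.2 fun f => by
      rw [tendsto_atTop_pnat_iff]
      simpa using hx f)
    rw [tendsto_atTop_pnat_iff] at this
    simpa using this

/-- By Hahn–Banach, largeness can be tested in the fixed space `C(2^ℕ)` instead of the varying
domain, which makes it measurable in the code. -/
theorem mem_largeSets_coe_iff {p : Submodule 𝕂 E} {ε : ℝ} {x : ℕ+ → p} {G : Finset ℕ+} :
    G ∈ largeSets 𝕂 ε (fun i => (x i : E)) ↔ G ∈ largeSets 𝕂 ε x := by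
  constructor
  · rintro ⟨f, hf, hG⟩
    refine ⟨f.comp p.subtypeL, ?_, hG⟩
    refine (f.comp p.subtypeL).opNorm_le_bound zero_le_one fun v => ?_
    simpa using f.le_of_opNorm_le hf (v : E)
  · rintro ⟨f, hf, hG⟩
    obtain ⟨g, hg, hgf⟩ := exists_extension_norm_eq p f
    exact ⟨g, hgf ▸ hf, fun n hn => by rw [hg]; exact hG n hn⟩

/-- Evaluation is jointly continuous on the weak-* compact dual ball times the sequences, and
projection along a compact factor is closed. -/
theorem isClosed_setOf_mem_largeSets (ε : ℝ) (G : Finset ℕ+) :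
    IsClosed {x : ℕ+ → E | G ∈ largeSets 𝕂 ε x} := by
  let B : Set (WeakDual 𝕂 E) := WeakDual.toStrongDual ⁻¹' Metric.closedBall 0 1
  have hB : IsCompact B := WeakDual.isCompact_closedBall 0 1
  have : CompactSpace B := isCompact_iff_compactSpace.1 hB
  have hnorm : ∀ (f : B) (v : E), ‖f.1 v‖ ≤ ‖v‖ := fun f v => by
    have h1 : ‖WeakDual.toStrongDual f.1‖ ≤ 1 := mem_closedBall_zero_iff.1 f.2
    simpa using (WeakDual.toStrongDual f.1).le_of_opNorm_le h1 v
  have hcont : ∀ n : ℕ+, Continuous fun q : B × (ℕ+ → E) => q.1.1 (q.2 n) := by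
    intro n
    rw [continuous_iff_continuousAt]
    rintro ⟨f₀, x₀⟩
    rw [ContinuousAt, tendsto_iff_norm_sub_tendsto_zero]
    have hlim : Tendsto (fun q : B × (ℕ+ → E) => ‖q.2 n - x₀ n‖ + ‖q.1.1 (x₀ n) - f₀.1 (x₀ n)‖)
        (𝓝 (f₀, x₀)) (𝓝 0) := by
      have hc : Continuous fun q : B × (ℕ+ → E) =>
          ‖q.2 n - x₀ n‖ + ‖q.1.1 (x₀ n) - f₀.1 (x₀ n)‖ := by
        refine Continuous.add (by fun_prop) (Continuous.norm (Continuous.sub ?_ continuous_const))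
        exact (WeakDual.eval_continuous (x₀ n)).comp (continuous_subtype_val.comp continuous_fst)
      simpa using hc.tendsto (f₀, x₀)
    refine squeeze_zero (fun _ => norm_nonneg _) (fun q => ?_) hlim
    have : q.1.1 (q.2 n) - f₀.1 (x₀ n) =
        q.1.1 (q.2 n - x₀ n) + (q.1.1 (x₀ n) - f₀.1 (x₀ n)) := by
      rw [map_sub]; ring
    rw [this]
    exact (norm_add_le _ _).trans (add_le_add_left (hnorm _ _) _)
  have hD : IsClosed {q : B × (ℕ+ → E) | ∀ n ∈ G, ε ≤ ‖q.1.1 (q.2 n)‖} := by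
    simp only [Set.ofPred_forall]
    exact isClosed_iInter fun n => isClosed_iInter fun _ =>
      isClosed_le continuous_const (hcont n).norm
  convert isClosedMap_snd_of_compactSpace _ hD using 1
  ext x
  constructor
  · rintro ⟨f, hf, hfG⟩
    exact ⟨(⟨WeakDual.toStrongDual.symm f, by simpa [B] using hf⟩, x), hfG, rfl⟩
  · rintro ⟨⟨f, x⟩, hfG, rfl⟩
    exact ⟨WeakDual.toStrongDual f.1, mem_closedBall_zero_iff.1 f.2, hfG⟩

end Large

/-! ### Codes of operators that are not completely continuous -/

namespace OperatorCode

variable {𝕂 : Type} [RCLike 𝕂] {s : DenseSelector 𝕂}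

theorem operator_point (c : OperatorCode s) (n : ℕ) : c.operator (c.point n) = c.value n :=
  (c.operator_eq_iff c.operator).1 rfl n

/-- A bad sequence is perturbed into the dense points: errors `1 / i` preserve weak nullness, and
errors `δ / (2 * (‖A‖ + 1))` keep the images of norm at least `δ / 2`. -/
theorem not_isFamilyCompletelyContinuous_iff {𝓕 : Set (Finset ℕ+)} (h𝓕 : IsSpreading 𝓕)
    (c : OperatorCode s) : ¬ IsFamilyCompletelyContinuous 𝓕 c.operator ↔
      ∃ m : ℕ+ → ℕ, IsFamilyWeaklyNull 𝕂 𝓕 (fun i => c.point (m i)) ∧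
        ∃ k : ℕ, ∀ i, 1 / ((k : ℝ) + 1) ≤ ‖c.value (m i)‖ := by
  constructor
  · intro h
    rw [IsFamilyCompletelyContinuous] at h
    push Not at h
    obtain ⟨x, hx, hAx⟩ := h
    obtain ⟨δ, L, hδ, hL, hδL⟩ := exists_strictMono_of_not_tendsto hAx
    have hpos : 0 < 2 * (‖c.operator‖ + 1) := by positivity
    have happrox : ∀ i : ℕ+, ∃ m, ‖x (L i) - c.point m‖ <
        min (1 / (i : ℝ)) (δ / (2 * (‖c.operator‖ + 1))) := fun i => by
      have hi : (0 : ℝ) < min (1 / (i : ℝ)) (δ / (2 * (‖c.operator‖ + 1))) :=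
        lt_min (one_div_pos.2 (Nat.cast_pos.2 i.pos)) (div_pos hδ hpos)
      obtain ⟨m, hm⟩ := c.point_denseRange.exists_dist_lt (x (L i)) hi
      exact ⟨m, by rwa [dist_eq_norm] at hm⟩
    choose m hm using happrox
    obtain ⟨k, hk⟩ := exists_nat_one_div_lt (half_pos hδ)
    refine ⟨m, (hx.comp hL).of_norm_sub_le h𝓕 fun i => ((hm i).trans_le (min_le_left _ _)).le,
      k, fun i => ?_⟩
    have h1 : ‖c.operator (x (L i)) - c.value (m i)‖ ≤ δ / 2 := by
      rw [← operator_point, ← map_sub]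
      calc ‖c.operator (x (L i) - c.point (m i))‖
          ≤ ‖c.operator‖ * ‖x (L i) - c.point (m i)‖ := c.operator.le_opNorm _
        _ ≤ (‖c.operator‖ + 1) * (δ / (2 * (‖c.operator‖ + 1))) := by
          gcongr
          · linarith
          · exact ((hm i).trans_le (min_le_right _ _)).le
        _ = δ / 2 := by field_simp
    have h2 := norm_sub_norm_le (c.operator (x (L i))) (c.value (m i))
    linarith [hδL i]
  · rintro ⟨m, hm, k, hk⟩ h
    have h1 := (h _ hm).norm
    rw [norm_zero] at h1
    have h2 : ∀ i, 1 / ((k : ℝ) + 1) ≤ ‖c.operator (c.point (m i))‖ := fun i => by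
      rw [operator_point]
      exact hk i
    exact (ge_of_tendsto' h1 h2).not_gt Nat.one_div_pos_of_nat

theorem mem_largeSets_point_iff (c : OperatorCode s) {ε : ℝ} {m : ℕ+ → ℕ} {G : Finset ℕ+} :
    G ∈ largeSets 𝕂 ε (fun i => c.point (m i)) ↔
      G ∈ largeSets 𝕂 ε (fun i => s.d (m i) c.1.1) :=
  mem_largeSets_coe_iff.symm

theorem measurable_d_comp (s : DenseSelector 𝕂) : Measurable fun w : OperatorCode s × ℕ =>
    s.d w.2 w.1.1.1 :=
  measurable_from_prod_countable_left fun n =>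
    (s.measurable n).comp (measurable_fst.comp measurable_subtype_coe)

theorem measurable_value (s : DenseSelector 𝕂) : Measurable fun w : OperatorCode s × ℕ =>
    w.1.1.2.2 w.2 :=
  measurable_from_prod_countable_left fun n => (measurable_pi_apply n).comp
    (measurable_snd.comp (measurable_snd.comp measurable_subtype_coe))

theorem measurableSet_mem_largeSets {W : Type*} [MeasurableSpace W] {c : W → OperatorCode s}
    {m : W → ℕ+ → ℕ} (hc : Measurable c) (hm : Measurable m) (ε : ℝ) (G : Finset ℕ+) :
    MeasurableSet {w | G ∈ largeSets 𝕂 ε (fun i => (c w).point (m w i))} := by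
  simp only [mem_largeSets_point_iff]
  have hx : Measurable fun w => fun i => s.d (m w i) (c w).1.1 :=
    measurable_pi_lambda _ fun i =>
      (measurable_d_comp s).comp (hc.prodMk ((measurable_pi_apply i).comp hm))
  exact hx (isClosed_setOf_mem_largeSets ε G).measurableSet

theorem measurableSet_forall_le_norm_value {W : Type*} [MeasurableSpace W] {c : W → OperatorCode s}
    {m : W → ℕ+ → ℕ} (hc : Measurable c) (hm : Measurable m) :
    MeasurableSet {w | ∃ k : ℕ, ∀ i, 1 / ((k : ℝ) + 1) ≤ ‖(c w).value (m w i)‖} := by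
  simp only [Set.ofPred_exists, Set.ofPred_forall]
  refine MeasurableSet.iUnion fun k => MeasurableSet.iInter fun i =>
    measurableSet_le measurable_const ?_
  exact ((measurable_value s).comp (hc.prodMk ((measurable_pi_apply i).comp hm))).norm

end OperatorCode

instance : MeasurableSpace ℕ+ := ⊤

instance : DiscreteMeasurableSpace ℕ+ := ⟨fun _ => trivial⟩

theorem measurableSet_strictMono_pnat : MeasurableSet {N : ℕ+ → ℕ+ | StrictMono N} := by
  simp only [StrictMono, Set.ofPred_forall]
  refine MeasurableSet.iInter fun i => MeasurableSet.iInter fun j => MeasurableSet.iInter fun _ => ?_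
  have h : Measurable fun N : ℕ+ → ℕ+ => (N i, N j) :=
    (measurable_pi_apply i).prodMk (measurable_pi_apply j)
  exact h (MeasurableSet.of_discrete (s := {q : ℕ+ × ℕ+ | q.1 < q.2}))

/-! ### Projective upper bounds for the classes of codes -/

section Complexity

variable {𝕂 : Type} [RCLike 𝕂] {s : DenseSelector 𝕂}

/-- The complement is the projection of the set of pairs of a code and a bad sequence. That set is
coanalytic, since failure of weak nullness is a countable union of projections of Borel sets. -/
theorem isPi12_completelyContinuousCodes [TopologicalSpace (OperatorCode s)]
    [PolishSpace (OperatorCode s)] [BorelSpace (OperatorCode s)] :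
    IsPi12 (completelyContinuousCodes s) := by
  refine ⟨OperatorCode s × (ℕ+ → ℕ), inferInstance, inferInstance,
    {w | IsFamilyWeaklyNull 𝕂 Set.univ (fun i => w.1.point (w.2 i)) ∧
      ∃ k : ℕ, ∀ i, 1 / ((k : ℝ) + 1) ≤ ‖w.1.value (w.2 i)‖}, Prod.fst, ?_, continuous_fst, ?_⟩
  · rw [IsPi11]
    let T : ℕ → Set ((OperatorCode s × (ℕ+ → ℕ)) × (ℕ+ → ℕ+)) := fun k =>
      {q | StrictMono q.2 ∧ ∀ G : Finset ℕ+,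
        G ∈ largeSets 𝕂 (1 / ((k : ℝ) + 1)) (fun i => q.1.1.point (q.1.2 (q.2 i)))}
    have hT : ∀ k, MeasurableSet (T k) := by
      intro k
      refine (measurable_snd measurableSet_strictMono_pnat).inter
        (?_ : MeasurableSet {q : (OperatorCode s × (ℕ+ → ℕ)) × (ℕ+ → ℕ+) | ∀ G : Finset ℕ+,
          G ∈ largeSets 𝕂 (1 / ((k : ℝ) + 1)) (fun i => q.1.1.point (q.1.2 (q.2 i)))})
      simp only [Set.ofPred_forall]
      refine MeasurableSet.iInter fun G => OperatorCode.measurableSet_mem_largeSets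
        (measurable_fst.comp measurable_fst) 
        (m := fun (q : (OperatorCode s × (ℕ+ → ℕ)) × (ℕ+ → ℕ+)) i => q.1.2 (q.2 i)) ?_ _ G
      refine measurable_pi_lambda _ fun i => ?_
      have h1 : Measurable fun v : (ℕ+ → ℕ) × ℕ+ => v.1 v.2 :=
        measurable_from_prod_countable_left fun n => measurable_pi_apply n
      exact h1.comp ((measurable_snd.comp measurable_fst).prodMk
        ((measurable_pi_apply i).comp measurable_snd))
    have heq : {w : OperatorCode s × (ℕ+ → ℕ) |
        IsFamilyWeaklyNull 𝕂 Set.univ (fun i => w.1.point (w.2 i)) ∧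
        ∃ k : ℕ, ∀ i, 1 / ((k : ℝ) + 1) ≤ ‖w.1.value (w.2 i)‖}ᶜ =
        (⋃ k, Prod.fst '' T k) ∪
          {w | ∃ k : ℕ, ∀ i, 1 / ((k : ℝ) + 1) ≤ ‖w.1.value (w.2 i)‖}ᶜ := by
      ext w
      rw [Set.mem_compl_iff, Set.mem_ofPred_eq, not_and_or, Set.mem_union]
      refine or_congr ?_ Iff.rfl
      rw [IsFamilyWeaklyNull, not_not, Set.mem_iUnion]
      constructor
      · rintro ⟨ε, N, hε, hN, hG⟩
        obtain ⟨k, hk⟩ := exists_nat_one_div_lt hε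
        exact ⟨k, (w, N), ⟨hN, fun G => mem_largeSets_of_le
          (image_mem_largeSets_iff.1 (hG G trivial)) hk.le⟩, rfl⟩
      · rintro ⟨k, ⟨w, N⟩, ⟨hN, hG⟩, rfl⟩
        exact ⟨_, N, Nat.one_div_pos_of_nat, hN, fun G _ => image_mem_largeSets_iff.2 (hG G)⟩
    rw [heq, Set.union_eq_iUnion]
    refine AnalyticSet.iUnion fun b => ?_
    cases b
    · exact (OperatorCode.measurableSet_forall_le_norm_value measurable_fst
        measurable_snd).compl.analyticSet
    · exact AnalyticSet.iUnion fun k => (hT k).analyticSet_image measurable_fst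
  · ext c
    rw [Set.mem_compl_iff, completelyContinuousCodes, Set.mem_ofPred_eq,
      isCompletelyContinuous_iff, OperatorCode.not_isFamilyCompletelyContinuous_iff
        (𝓕 := Set.univ) (fun _ _ _ _ => trivial)]
    constructor
    · rintro ⟨⟨c, m⟩, h, rfl⟩
      exact ⟨m, h⟩
    · rintro ⟨m, h⟩
      exact ⟨(c, m), h, rfl⟩

/-- A weakly null sequence of order `ξ` has a subsequence whose large sets are smaller than the
Schreier family of order `ξ`. -/
theorem IsSchreierApprox.exists_strictMono_of_isFamilyWeaklyNull {ξ : Ordinal.{0}}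
    {𝓕 : Set (Finset ℕ+)} {𝓖 : ℕ+ → Set (Finset ℕ+)} (h : IsSchreierApprox ξ 𝓕 𝓖)
    {E : Type} [NormedAddCommGroup E] [NormedSpace 𝕂 E] {x : ℕ+ → E}
    (hx : IsFamilyWeaklyNull 𝕂 𝓕 x) :
    ∃ L : ℕ+ → ℕ+, StrictMono L ∧ ∀ k : ℕ, ∃ n p : ℕ+, ∀ G : Finset ℕ+, (∀ a ∈ G, p ≤ a) →
      G ∈ largeSets 𝕂 (1 / ((k : ℝ) + 1)) (x ∘ L) → G.image L ∈ 𝓖 n := by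
  classical
  -- If no `𝓖 n` absorbed the large sets, the dichotomy would make every `𝓖 n` consist of large sets
  -- on some smaller set; along a diagonal set all of `𝓕` would be large, against weak nullness.
  have hstep : ∀ ε : ℝ, 0 < ε → ∀ M : Set ℕ+, M.Infinite → ∃ L ⊆ M, L.Infinite ∧
      ∃ n, ∀ G : Finset ℕ+, (G : Set ℕ+) ⊆ L → G ∈ largeSets 𝕂 ε x → G ∈ 𝓖 n := by
    intro ε hε M hM
    by_contra hcon
    push Not at hcon
    obtain ⟨L, hLM, hL, hdiag⟩ := exists_infinite_diagonal
      (fun n L => ∀ G : Finset ℕ+, (G : Set ℕ+) ⊆ L → G ∈ 𝓖 n → G ∈ largeSets 𝕂 ε x)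
      (fun n L L' hL hQ G hG => hQ G (hG.trans hL)) hM (fun n L hLM hL => by
        obtain ⟨L', hL'L, hL', h1 | h1⟩ := exists_infinite_subset_or_subset
          (isLowerSet_largeSets (𝕂 := 𝕂) ε x) (h.isLowerSet n) hL
        · obtain ⟨G, hG, hGl, hGn⟩ := hcon L' (hL'L.trans hLM) hL' n
          exact absurd (h1 G hG hGl) hGn
        · exact ⟨L', hL'L, hL', h1⟩)
    obtain ⟨N, hN, hNL⟩ := hL.exists_strictMono_mem
    -- The shift sends a set `G ≥ n` strictly beyond `N n`, where the requirement for `n` is in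
    -- force.
    have hadd : StrictMono fun i : ℕ+ => i + 1 := fun i j hij => add_lt_add_left hij _
    refine hx ⟨ε, fun i => N (i + 1), hε, hN.comp hadd, fun G hG => ?_⟩
    rw [h.eq] at hG
    obtain ⟨n, hn, hG⟩ := hG
    refine hdiag (N n) (hNL n) n hN.le_apply _ ?_ (h.isSpreading n G hG _ (hN.comp hadd))
    intro a ha
    obtain ⟨i, hi, rfl⟩ := Finset.mem_image.1 (Finset.mem_coe.1 ha)
    exact ⟨hNL _, hN ((hn i hi).trans_lt (PNat.lt_add_right i 1))⟩
  -- A second diagonalisation treats all thresholds at once; each holds only on a tail, whence `p`.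
  obtain ⟨M, -, hM, hdiag⟩ := exists_infinite_diagonal
    (fun k L => ∃ n, ∀ G : Finset ℕ+, (G : Set ℕ+) ⊆ L →
      G ∈ largeSets 𝕂 (1 / ((k : ℝ) + 1)) x → G ∈ 𝓖 n)
    (fun k L L' hL hQ => hQ.imp fun n hn G hG => hn G (hG.trans hL)) Set.infinite_univ
    (fun k L _ hL => hstep _ (by positivity) L hL)
  obtain ⟨L, hL, hLM⟩ := hM.exists_strictMono_mem
  refine ⟨L, hL, fun k => ?_⟩
  obtain ⟨n, hn⟩ := hdiag (L k.succPNat) (hLM _) k.succPNat hL.le_apply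
  refine ⟨n, k.succPNat + 1, fun G hG hGl => hn _ ?_ ?_⟩
  · intro a ha
    obtain ⟨i, hi, rfl⟩ := Finset.mem_image.1 (Finset.mem_coe.1 ha)
    exact ⟨hLM _, hL ((PNat.lt_add_right _ 1).trans_le (hG i hi))⟩
  · refine mem_largeSets_of_le (image_mem_largeSets_iff.2 hGl) ?_
    refine one_div_le_one_div_of_le (by positivity) ?_
    simp

theorem isPi11_familyCompletelyContinuousCodes [TopologicalSpace (OperatorCode s)]
    [PolishSpace (OperatorCode s)] [BorelSpace (OperatorCode s)] {ξ : Ordinal.{0}} (hξ : ξ ≠ 0)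
    {𝓕 : Set (Finset ℕ+)} {𝓖 : ℕ+ → Set (Finset ℕ+)} (h : IsSchreierApprox ξ 𝓕 𝓖) :
    IsPi11 (familyCompletelyContinuousCodes s 𝓕) := by
  classical
  have h𝓕 := h.isSchreierFamily hξ
  let T : Set (OperatorCode s × (ℕ+ → ℕ) × (ℕ+ → ℕ+)) :=
    {w | StrictMono w.2.2 ∧ (∃ k : ℕ, ∀ i, 1 / ((k : ℝ) + 1) ≤ ‖w.1.value (w.2.1 i)‖) ∧
      ∀ k : ℕ, ∃ n p : ℕ+, ∀ G : Finset ℕ+, (∀ a ∈ G, p ≤ a) →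
        G ∈ largeSets 𝕂 (1 / ((k : ℝ) + 1)) (fun i => w.1.point (w.2.1 i)) →
          G.image w.2.2 ∈ 𝓖 n}
  have hT : MeasurableSet T := by
    refine ((measurable_snd.comp measurable_snd) measurableSet_strictMono_pnat).inter
      (MeasurableSet.inter (OperatorCode.measurableSet_forall_le_norm_value measurable_fst
        (measurable_fst.comp measurable_snd))
        (?_ : MeasurableSet {w : OperatorCode s × (ℕ+ → ℕ) × (ℕ+ → ℕ+) |
          ∀ k : ℕ, ∃ n p : ℕ+, ∀ G : Finset ℕ+, (∀ a ∈ G, p ≤ a) →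
            G ∈ largeSets 𝕂 (1 / ((k : ℝ) + 1)) (fun i => w.1.point (w.2.1 i)) →
              G.image w.2.2 ∈ 𝓖 n}))
    simp only [Set.ofPred_forall, Set.ofPred_exists]
    refine MeasurableSet.iInter fun k => MeasurableSet.iUnion fun n => MeasurableSet.iUnion fun p =>
      MeasurableSet.iInter fun G => MeasurableSet.iInter fun _ => ?_
    refine (OperatorCode.measurableSet_mem_largeSets measurable_fst
        (measurable_fst.comp measurable_snd) _ G).imp ?_
    have h1 : Measurable fun w : OperatorCode s × (ℕ+ → ℕ) × (ℕ+ → ℕ+) => fun a : G => w.2.2 a :=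
      measurable_pi_lambda _ fun a =>
        (measurable_pi_apply a.1).comp (measurable_snd.comp measurable_snd)
    convert h1 (MeasurableSet.of_discrete (s := {v : G → ℕ+ | Finset.univ.image v ∈ 𝓖 n})) using 1
    ext w
    have : G.image w.2.2 = Finset.univ.image (fun a : G => w.2.2 a) := by
      ext b
      simp
    simp [this]
  rw [IsPi11]
  convert hT.analyticSet_image measurable_fst using 1
  ext c
  rw [Set.mem_compl_iff, familyCompletelyContinuousCodes, Set.mem_ofPred_eq,
    OperatorCode.not_isFamilyCompletelyContinuous_iff h𝓕.isSpreading]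
  constructor
  · rintro ⟨m, hm, k, hk⟩
    obtain ⟨L, hL, hLG⟩ := h.exists_strictMono_of_isFamilyWeaklyNull hm
    exact ⟨(c, m ∘ L, L), ⟨hL, ⟨k, fun i => hk (L i)⟩, hLG⟩, rfl⟩
  · rintro ⟨⟨c, m, L⟩, ⟨hL, hk, hLG⟩, rfl⟩
    refine ⟨m, ?_, hk⟩
    rintro ⟨ε, N, hε, hN, hG⟩
    obtain ⟨k, hk⟩ := exists_nat_one_div_lt hε
    obtain ⟨n, p, hnp⟩ := hLG k
    -- If all of `𝓕` were large along `N`, then `L ∘ N` would carry the part of `𝓕` beyond `p` into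
    -- `𝓖 n`, which the ranks forbid.
    refine h.not_forall_image_mem hξ (hL.comp hN) n p fun G hGF hpG => ?_
    rw [← Finset.image_image]
    refine hnp _ (fun a ha => ?_) (mem_largeSets_of_le (hG G hGF) hk.le)
    obtain ⟨i, hi, rfl⟩ := Finset.mem_image.1 ha
    exact (hpG i hi).le.trans hN.le_apply

end Complexity

/-! ### Weakly null sequences of indicators of clopen sets -/

section Clopen

open TopologicalSpace

variable {K : Type} [TopologicalSpace K]

/-- A bounded modular function on the clopen sets is eventually small along a point-finite
sequence. -/
theorem eventually_lt_of_modular [CompactSpace K] {μ : Clopens K → ℝ} {b : ℝ} (hb : ∀ C, μ C ≤ b) (h0 : μ ⊥ = 0)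
    (hmod : ∀ C D, μ C + μ D = μ (C ⊔ D) + μ (C ⊓ D)) {C : ℕ → Clopens K}
    (hC : ∀ x, {k | x ∈ C k}.Finite) {ε : ℝ} (hε : 0 < ε) : ∀ᶠ k in atTop, μ (C k) < ε := by
  by_contra hcon
  rw [not_eventually] at hcon
  simp only [not_lt] at hcon
  obtain ⟨φ, hφ, hφε⟩ := extraction_of_frequently_atTop hcon
  -- Taking suprema over clopen subsets makes the function monotone; modularity of `μ` makes it
  -- supermodular.
  let ν : Clopens K → ℝ := fun C => ⨆ D : Set.Iic C, μ D
  have hbdd : ∀ C : Clopens K, BddAbove (Set.range fun D : Set.Iic C => μ D) := fun C =>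
    ⟨b, by rintro _ ⟨D, rfl⟩; exact hb _⟩
  have hμν : ∀ D C : Clopens K, D ≤ C → μ D ≤ ν C := fun D C h =>
    le_ciSup (hbdd C) (⟨D, h⟩ : Set.Iic C)
  have hνb : ∀ C, ν C ≤ b := fun C => ciSup_le fun D => hb _
  have hνmono : Monotone ν := fun C C' h => ciSup_le fun D => hμν _ _ (D.2.trans h)
  have hν0 : ν ⊥ = 0 := by
    refine le_antisymm (ciSup_le fun D => ?_) (h0 ▸ hμν ⊥ ⊥ le_rfl)
    rw [le_bot_iff.1 (show (D : Clopens K) ≤ ⊥ from D.2), h0]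
  have hsub : ∀ C D, ν C + ν D ≤ ν (C ⊔ D) + ν (C ⊓ D) := by
    intro C D
    rw [← le_sub_iff_add_le]
    refine ciSup_le fun C' => ?_
    rw [le_sub_comm]
    refine ciSup_le fun D' => ?_
    have h1 := hmod C' D'
    have h2 := hμν _ _ (sup_le_sup C'.2 D'.2)
    have h3 := hμν _ _ (inf_le_inf C'.2 D'.2)
    linarith
  let U : ℕ → ℕ → Clopens K := fun n j => (Finset.Ico n j).sup fun m => C (φ m)
  let a : ℕ → ℝ := fun n => ⨆ j, ν (U n j)
  have hUa : ∀ n j, ν (U n j) ≤ a n := fun n j =>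
    le_ciSup (f := fun j => ν (U n j)) ⟨b, by rintro _ ⟨D, rfl⟩; exact hνb _⟩ j
  have hεa : ∀ n, ε ≤ a n := fun n => by
    refine (hφε n).trans ((hμν _ _ ?_).trans (hUa n (n + 1)))
    exact Finset.le_sup (f := fun m => C (φ m)) (by simp)
  have hj : ∀ n, ∃ j, a n - ε / 2 * (1 / 2) ^ (n + 1) < ν (U n j) := fun n =>
    exists_lt_of_lt_ciSup (sub_lt_self _ (by positivity))
  choose j hj using hj
  -- `H n` is a finite union of sets `C (φ m)`, `m ≥ n`, with `ν` nearly `a n`. As the errors are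
  -- geometric, supermodularity keeps `ν (I n)` above `a n - ε / 2 > 0`. So the `I n` are nonempty,
  -- and compactness gives a point in infinitely many `C k`.
  let H : ℕ → Clopens K := fun n => U n (j n)
  let I : ℕ → Clopens K := fun n => (Finset.range (n + 1)).inf H
  have hI : ∀ n, a n - ε / 2 * (1 - (1 / 2) ^ (n + 1)) ≤ ν (I n) := by
    intro n
    induction n with
    | zero =>
      have : I 0 = H 0 := by simp [I]
      rw [this]
      have := (hj 0).le
      norm_num at this ⊢
      linarith
    | succ n ih =>
      have hIs : I (n + 1) = I n ⊓ H (n + 1) := by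
        simp only [I]
        rw [Finset.range_add_one, Finset.inf_insert, inf_comm]
      have h1 := hsub (I n) (H (n + 1))
      rw [← hIs] at h1
      have h2 : ν (I n ⊔ H (n + 1)) ≤ a n := by
        refine (hνmono ?_).trans (hUa n (max (j n) (j (n + 1))))
        refine sup_le ?_ ?_
        · refine (Finset.inf_le (Finset.self_mem_range_succ n)).trans ?_
          exact Finset.sup_mono (Finset.Ico_subset_Ico le_rfl (le_max_left _ _))
        · exact Finset.sup_mono (Finset.Ico_subset_Ico n.le_succ (le_max_right _ _))
      have h3 := (hj (n + 1)).le
      have h4 : (1 / 2 : ℝ) ^ (n + 1 + 1) = (1 / 2) ^ (n + 1) * (1 / 2) := pow_succ _ _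
      simp only [H] at h1 h2 h3
      rw [h4] at h3 ⊢
      nlinarith
  have hne : ∀ n, (I n : Set K).Nonempty := by
    intro n
    by_contra hemp
    rw [Set.not_nonempty_iff_eq_empty] at hemp
    have : I n = ⊥ := SetLike.coe_injective hemp
    have h1 := hI n
    rw [this, hν0] at h1
    have h2 : 0 < (1 / 2 : ℝ) ^ (n + 1) := by positivity
    nlinarith [hεa n]
  obtain ⟨x, hx⟩ := IsCompact.nonempty_iInter_of_sequence_nonempty_isCompact_isClosed
    (fun n => (I n : Set K)) (fun n => by
      have : I (n + 1) ≤ I n := Finset.inf_mono (Finset.range_mono (Nat.succ_le_succ n.le_succ))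
      exact this) hne (I 0).isClopen.isClosed.isCompact (fun n => (I n).isClopen.isClosed)
  have hinf : {k | x ∈ C k}.Infinite := by
    refine Set.infinite_of_forall_exists_gt fun n => ?_
    have h1 : I (n + 1) ≤ H (n + 1) := Finset.inf_le (Finset.self_mem_range_succ _)
    have h2 : x ∈ H (n + 1) := h1 (Set.mem_iInter.1 hx (n + 1))
    have h3 : ∀ T : Finset ℕ, x ∈ T.sup (fun m => C (φ m)) → ∃ m ∈ T, x ∈ C (φ m) := by
      intro T
      induction T using Finset.induction_on with
      | empty => intro h; exact absurd h (by simp [← SetLike.mem_coe])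
      | insert m T _ ih =>
        intro h
        rw [Finset.sup_insert] at h
        rcases (h : x ∈ C (φ m) ∨ x ∈ T.sup fun m => C (φ m)) with h | h
        · exact ⟨m, Finset.mem_insert_self m T, h⟩
        · obtain ⟨m', hm', h⟩ := ih h
          exact ⟨m', Finset.mem_insert_of_mem hm', h⟩
    obtain ⟨m, hm, hxm⟩ := h3 _ h2
    exact ⟨φ m, hxm, (Nat.lt_of_succ_le (Finset.mem_Ico.1 hm).1).trans_le (hφ.le_apply)⟩
  exact hinf (hC x)

variable (𝕂 : Type) [RCLike 𝕂]

open Classical in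
/-- The indicator function of a clopen set. -/
noncomputable def clopenIndicator (C : Clopens K) : C(K, 𝕂) where
  toFun x := if x ∈ C then 1 else 0
  continuous_toFun := by
    have := C.isClopen
    exact (continuous_const (y := (1 : 𝕂))).if (fun x hx => by
      have hx' : x ∈ frontier (C : Set K) := hx
      rw [C.isClopen.frontier_eq] at hx'
      exact hx'.elim) (continuous_const (y := (0 : 𝕂)))

open Classical in
theorem clopenIndicator_apply (C : Clopens K) (x : K) :
    clopenIndicator 𝕂 C x = if x ∈ C then 1 else 0 := rfl

variable {𝕂}

/-- The real part of `ψ` is a bounded modular function of clopen sets; passing to `-ψ` and `-iψ`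
covers the other sign and the imaginary part. -/
theorem tendsto_apply_clopenIndicator [CompactSpace K] (ψ : StrongDual 𝕂 C(K, 𝕂)) {C : ℕ → Clopens K}
    (hC : ∀ x, {k | x ∈ C k}.Finite) :
    Tendsto (fun k => ψ (clopenIndicator 𝕂 (C k))) atTop (𝓝 0) := by
  classical
  have hre : ∀ (ψ : StrongDual 𝕂 C(K, 𝕂)) (ε : ℝ), 0 < ε →
      ∀ᶠ k in atTop, RCLike.re (ψ (clopenIndicator 𝕂 (C k))) < ε := by
    intro ψ ε hε
    refine eventually_lt_of_modular (μ := fun C => RCLike.re (ψ (clopenIndicator 𝕂 C)))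
      (b := ‖ψ‖) (fun C => ?_) ?_ (fun C D => ?_) hC hε
    · refine (RCLike.re_le_norm _).trans ((ψ.le_opNorm _).trans ?_)
      refine mul_le_of_le_one_right (norm_nonneg _) ((ContinuousMap.norm_le _ zero_le_one).2 ?_)
      intro x
      rw [clopenIndicator_apply]
      split_ifs <;> simp
    · have : clopenIndicator 𝕂 (⊥ : Clopens K) = 0 := by
        ext x
        rw [clopenIndicator_apply, if_neg (by simp [← SetLike.mem_coe])]
        rfl
      simp [this]
    · rw [← map_add, ← map_add, ← map_add, ← map_add]
      congr 2
      ext x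
      simp only [ContinuousMap.add_apply, clopenIndicator_apply]
      have h1 : x ∈ C ⊔ D ↔ x ∈ C ∨ x ∈ D := Iff.rfl
      have h2 : x ∈ C ⊓ D ↔ x ∈ C ∧ x ∈ D := Iff.rfl
      by_cases hxC : x ∈ C <;> by_cases hxD : x ∈ D <;> simp [h1, h2, hxC, hxD]
  have hre' : ∀ ψ : StrongDual 𝕂 C(K, 𝕂),
      Tendsto (fun k => RCLike.re (ψ (clopenIndicator 𝕂 (C k)))) atTop (𝓝 0) := by
    intro ψ
    rw [Metric.tendsto_nhds]
    intro ε hε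
    filter_upwards [hre ψ ε hε, hre (-ψ) ε hε] with k h1 h2
    rw [Real.dist_eq, sub_zero, abs_lt]
    simp only [neg_apply, map_neg] at h2
    exact ⟨by linarith, h1⟩
  have h1 := hre' ψ
  have h2 := hre' ((-RCLike.I : 𝕂) • ψ)
  have h3 : ∀ k, RCLike.re (((-RCLike.I : 𝕂) • ψ) (clopenIndicator 𝕂 (C k))) =
      RCLike.im (ψ (clopenIndicator 𝕂 (C k))) := by
    intro k
    rw [smul_apply, smul_eq_mul, neg_mul, map_neg, RCLike.I_mul_re, neg_neg]
  simp only [h3] at h2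
  have h4 := ((RCLike.continuous_ofReal (K := 𝕂)).tendsto 0).comp h1 |>.add
    ((((RCLike.continuous_ofReal (K := 𝕂)).tendsto 0).comp h2).mul_const RCLike.I)
  simpa [Function.comp_def, RCLike.re_add_im] using h4

end Clopen

/-! ### Spaces of functions on the Cantor set that code families of finite sets -/

section Family

variable (𝕂 : Type) [RCLike 𝕂]

/-- The elements less than `k` of a point of the Cantor set. -/
def below (E : ℕ → Bool) (k : ℕ) : Finset ℕ := (Finset.range k).filter fun i => E i = true

/-- A finite set as a point of the Cantor set. -/
def cantorPoint (H : Finset ℕ) : ℕ → Bool := fun i => decide (i ∈ H)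

theorem mem_below {E : ℕ → Bool} {k i : ℕ} : i ∈ below E k ↔ i < k ∧ E i = true := by
  simp [below]

theorem isLocallyConstant_below (k : ℕ) : IsLocallyConstant fun E => below E k := by
  refine (IsLocallyConstant.iff_exists_open _).2 fun E =>
    ⟨⋂ i ∈ Finset.range k, {E' | E' i = E i}, ?_, by simp, ?_⟩
  · exact isOpen_biInter_finset fun i _ =>
      (isOpen_discrete ({E i} : Set Bool)).preimage
        (continuous_apply i : Continuous fun E' : ℕ → Bool => E' i)
  · intro E' hE'
    simp only [Set.mem_iInter, Set.mem_ofPred_eq] at hE'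
    ext i
    rw [mem_below, mem_below]
    refine and_congr_right fun hi => ?_
    rw [hE' i (Finset.mem_range.2 hi)]

/-- The clopen set of all `E` in the Cantor set with `E ∩ [0, k) ∈ 𝓗`. -/
def belowClopen (k : ℕ) (𝓗 : Set (Finset ℕ)) : TopologicalSpace.Clopens (ℕ → Bool) :=
  ⟨{E | below E k ∈ 𝓗}, ⟨isLocallyConstant_below k 𝓗ᶜ⟩, isLocallyConstant_below k 𝓗⟩

/-- The clopen set of all `E` in the Cantor set with `n ∈ E` and `E ∩ [0, n] ∈ 𝓕`. -/
def basisClopen (𝓕 : Set (Finset ℕ)) (n : ℕ) : TopologicalSpace.Clopens (ℕ → Bool) :=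
  belowClopen (n + 1) {H | n ∈ H ∧ H ∈ 𝓕}

/-- The function on the Cantor set that extends `E ↦ 1_E(n)` from the closure of `𝓕`. -/
noncomputable def basisFun (𝓕 : Set (Finset ℕ)) (n : ℕ) : CantorC 𝕂 :=
  clopenIndicator 𝕂 (basisClopen 𝓕 n)

/-- The closed linear span of the functions `basisFun 𝕂 𝓕 n`. -/
noncomputable def familySpace (𝓕 : Set (Finset ℕ)) : SB 𝕂 :=
  (Submodule.span 𝕂 (Set.range (basisFun 𝕂 𝓕))).closure

variable {𝕂}

theorem mem_basisClopen {𝓕 : Set (Finset ℕ)} {n : ℕ} {E : ℕ → Bool} :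
    E ∈ basisClopen 𝓕 n ↔ E n = true ∧ below E (n + 1) ∈ 𝓕 := by
  change n ∈ below E (n + 1) ∧ _ ↔ _
  rw [mem_below]
  simp

open Classical in
theorem basisFun_apply (𝓕 : Set (Finset ℕ)) (n : ℕ) (E : ℕ → Bool) :
    basisFun 𝕂 𝓕 n E = if E n = true ∧ below E (n + 1) ∈ 𝓕 then 1 else 0 := by
  rw [basisFun, clopenIndicator_apply]
  simp only [mem_basisClopen]

theorem below_cantorPoint_subset (H : Finset ℕ) (k : ℕ) : below (cantorPoint H) k ⊆ H := by
  intro i hi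
  simpa [cantorPoint] using (mem_below.1 hi).2

theorem basisFun_cantorPoint {𝓕 : Set (Finset ℕ)} (h𝓕 : IsLowerSet 𝓕) {H : Finset ℕ}
    (hH : H ∈ 𝓕) (n : ℕ) : basisFun 𝕂 𝓕 n (cantorPoint H) = if n ∈ H then 1 else 0 := by
  rw [basisFun_apply]
  congr 1
  rw [eq_iff_iff]
  constructor
  · rintro ⟨h, -⟩
    simpa [cantorPoint] using h
  · intro h
    exact ⟨by simpa [cantorPoint] using h, h𝓕 (below_cantorPoint_subset H _) hH⟩

theorem basisFun_mem_familySpace (𝓕 : Set (Finset ℕ)) (n : ℕ) :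
    basisFun 𝕂 𝓕 n ∈ familySpace 𝕂 𝓕 :=
  Submodule.le_topologicalClosure _ (Submodule.subset_span ⟨n, rfl⟩)

/-- Only the finitely many `H ⊆ [0, n]` matter, so this is a finite sum of fixed indicators with
measurable coefficients. -/
theorem measurable_basisFun {Ω : Type*} [MeasurableSpace Ω] {𝓕 : Ω → Set (Finset ℕ)}
    (h𝓕 : ∀ H, MeasurableSet {y | H ∈ 𝓕 y}) (n : ℕ) :
    Measurable fun y => basisFun 𝕂 (𝓕 y) n := by
  classical
  have heq : (fun y => basisFun 𝕂 (𝓕 y) n) = fun y =>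
      ∑ H ∈ (Finset.range (n + 1)).powerset, if n ∈ H ∧ H ∈ 𝓕 y then
        clopenIndicator 𝕂 (belowClopen (n + 1) {H}) else 0 := by
    funext y
    ext E
    rw [ContinuousMap.sum_apply, Finset.sum_eq_single (below E (n + 1))]
    · have h1 : E ∈ belowClopen (n + 1) {below E (n + 1)} := rfl
      rw [basisFun_apply]
      by_cases h : n ∈ below E (n + 1) ∧ below E (n + 1) ∈ 𝓕 y
      · rw [if_pos h, clopenIndicator_apply, if_pos h1, if_pos ⟨(mem_below.1 h.1).2, h.2⟩]
      · rw [if_neg h, if_neg fun h' => h ⟨mem_below.2 ⟨n.lt_succ_self, h'.1⟩, h'.2⟩]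
        rfl
    · intro H _ hH
      have h1 : E ∉ belowClopen (n + 1) {H} := fun h => hH (show below E (n + 1) = H from h).symm
      split_ifs
      · rw [clopenIndicator_apply, if_neg h1]
      · rfl
    · intro h
      exact absurd (Finset.mem_powerset.2 (Finset.filter_subset _ _)) h
  rw [heq]
  refine Finset.measurable_sum _ fun H _ => Measurable.ite ?_ measurable_const measurable_const
  by_cases hn : n ∈ H
  · simpa [hn] using h𝓕 H
  · simp [hn]

theorem measurable_familySpace {Ω : Type*} [MeasurableSpace Ω] {𝓕 : Ω → Set (Finset ℕ)}
    (h𝓕 : ∀ H, MeasurableSet {y | H ∈ 𝓕 y}) : Measurable fun y => familySpace 𝕂 (𝓕 y) := by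
  refine measurable_generateFrom ?_
  rintro _ ⟨U, hU, rfl⟩
  have heq : (fun y => familySpace 𝕂 (𝓕 y)) ⁻¹'
      {X : SB 𝕂 | ((X : Set (CantorC 𝕂)) ∩ U).Nonempty} = ⋃ n : ℕ, ⋃ j : ℕ,
        {y | ∑ i ∈ Finset.range n, TopologicalSpace.denseSeq (ℕ → 𝕂) j i • basisFun 𝕂 (𝓕 y) i ∈
          U} := by
    ext y
    simp only [Set.mem_preimage, Set.mem_ofPred_eq, Set.mem_iUnion]
    have hcl : (familySpace 𝕂 (𝓕 y) : Set (CantorC 𝕂)) =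
      closure (Submodule.span 𝕂 (Set.range (basisFun 𝕂 (𝓕 y))) : Set (CantorC 𝕂)) := rfl
    rw [hcl, closure_inter_open_nonempty_iff hU]
    constructor
    · rintro ⟨x, hx, hxU⟩
      obtain ⟨a, rfl⟩ := (Finsupp.mem_span_range_iff_exists_finsupp).1 hx
      obtain ⟨n, hn⟩ := a.support.exists_nat_subset_range
      have hopen : IsOpen {b : ℕ → 𝕂 |
          ∑ i ∈ Finset.range n, b i • basisFun 𝕂 (𝓕 y) i ∈ U} :=
        hU.preimage (by fun_prop)
      obtain ⟨j, hj⟩ := (TopologicalSpace.denseRange_denseSeq (ℕ → 𝕂)).exists_mem_open hopen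
        ⟨a, by
          rw [Finsupp.sum_of_support_subset a hn _ (by simp)] at hxU
          exact hxU⟩
      exact ⟨n, j, hj⟩
    · rintro ⟨n, j, h⟩
      exact ⟨_, Submodule.sum_mem _ fun i _ => Submodule.smul_mem _ _
        (Submodule.subset_span ⟨i, rfl⟩), h⟩
  rw [heq]
  refine MeasurableSet.iUnion fun n => MeasurableSet.iUnion fun j => ?_
  have : Measurable fun y => ∑ i ∈ Finset.range n,
      TopologicalSpace.denseSeq (ℕ → 𝕂) j i • basisFun 𝕂 (𝓕 y) i :=
    Finset.measurable_sum _ fun i _ => (measurable_basisFun h𝓕 i).const_smul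
      (TopologicalSpace.denseSeq (ℕ → 𝕂) j i)
  exact this hU.measurableSet

theorem familySpace_induction {𝓕 : Set (Finset ℕ)} (ℓ : StrongDual 𝕂 (CantorC 𝕂))
    (h : ∀ n, ℓ (basisFun 𝕂 𝓕 n) = 0) {x : CantorC 𝕂} (hx : x ∈ familySpace 𝕂 𝓕) : ℓ x = 0 := by
  have hle : (Submodule.span 𝕂 (Set.range (basisFun 𝕂 𝓕))).topologicalClosure ≤
      LinearMap.ker (ℓ : CantorC 𝕂 →ₗ[𝕂] 𝕂) := by
    refine Submodule.topologicalClosure_minimal _ (Submodule.span_le.2 ?_) ℓ.isClosed_ker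
    rintro _ ⟨n, rfl⟩
    exact h n
  exact hle hx

theorem apply_cantorPoint_empty {𝓕 : Set (Finset ℕ)} {x : CantorC 𝕂}
    (hx : x ∈ familySpace 𝕂 𝓕) : x (cantorPoint ∅) = 0 :=
  familySpace_induction (ContinuousMap.evalCLM 𝕂 (cantorPoint ∅)) (fun n => by
    rw [ContinuousMap.evalCLM_apply, basisFun_apply, if_neg]
    simp [cantorPoint]) hx

/-- The identity is linear and continuous in `x` and holds for the generators. It makes a large
coordinate visible at any member of `𝓕` whose remaining part contributes little. -/
theorem apply_cantorPoint_insert {𝓕 : Set (Finset ℕ)} (h𝓕 : IsLowerSet 𝓕) {x : CantorC 𝕂}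
    (hx : x ∈ familySpace 𝕂 𝓕) {H : Finset ℕ} {n : ℕ} (hn : n ∉ H) (hH : insert n H ∈ 𝓕) :
    x (cantorPoint (insert n H)) = x (cantorPoint H) + x (cantorPoint {n}) := by
  have h := familySpace_induction (𝕂 := 𝕂) (ContinuousMap.evalCLM 𝕂 (cantorPoint (insert n H)) -
    (ContinuousMap.evalCLM 𝕂 (cantorPoint H) + ContinuousMap.evalCLM 𝕂 (cantorPoint {n})))
    (fun i => ?_) hx
  · simpa [sub_eq_zero] using h
  · have h1 : H ∈ 𝓕 := h𝓕 (Finset.subset_insert n H) hH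
    have h2 : {n} ∈ 𝓕 := h𝓕 (Finset.singleton_subset_iff.2 (Finset.mem_insert_self n H)) hH
    simp only [sub_apply, add_apply, ContinuousMap.evalCLM_apply, basisFun_cantorPoint h𝓕 h1,
      basisFun_cantorPoint h𝓕 h2, basisFun_cantorPoint h𝓕 hH, Finset.mem_insert,
      Finset.mem_singleton]
    by_cases hi : i = n
    · subst hi
      simp [hn]
    · simp [hi]

/-- The members of `familySpace 𝕂 𝓕` are uniformly continuous. -/
theorem exists_forall_agree_norm_sub_lt {𝓕 : Set (Finset ℕ)} {x : CantorC 𝕂}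
    (hx : x ∈ familySpace 𝕂 𝓕) {ε : ℝ} (hε : 0 < ε) :
    ∃ N, ∀ E E' : ℕ → Bool, (∀ i < N, E i = E' i) → ‖x E - x E'‖ < ε := by
  have hspan : ∀ g ∈ Submodule.span 𝕂 (Set.range (basisFun 𝕂 𝓕)),
      ∃ N, ∀ E E' : ℕ → Bool, (∀ i < N, E i = E' i) → g E = g E' := by
    intro g hg
    induction hg using Submodule.span_induction with
    | mem g hg =>
      obtain ⟨n, rfl⟩ := hg
      refine ⟨n + 1, fun E E' h => ?_⟩
      have hbelow : below E (n + 1) = below E' (n + 1) := by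
        ext i
        rw [mem_below, mem_below]
        exact and_congr_right fun hi => by rw [h i hi]
      rw [basisFun_apply, basisFun_apply, hbelow, h n n.lt_succ_self]
    | zero => exact ⟨0, fun _ _ _ => rfl⟩
    | add g g' _ _ hg hg' =>
      obtain ⟨N, hN⟩ := hg
      obtain ⟨N', hN'⟩ := hg'
      refine ⟨max N N', fun E E' h => ?_⟩
      rw [ContinuousMap.add_apply, ContinuousMap.add_apply,
        hN E E' fun i hi => h i (hi.trans_le (le_max_left _ _)),
        hN' E E' fun i hi => h i (hi.trans_le (le_max_right _ _))]
    | smul a g _ hg =>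
      obtain ⟨N, hN⟩ := hg
      refine ⟨N, fun E E' h => ?_⟩
      rw [ContinuousMap.smul_apply, ContinuousMap.smul_apply, hN E E' h]
  have hcl : x ∈ closure (Submodule.span 𝕂 (Set.range (basisFun 𝕂 𝓕)) : Set (CantorC 𝕂)) := hx
  obtain ⟨g, hg, hxg⟩ := Metric.mem_closure_iff.1 hcl (ε / 2) (half_pos hε)
  obtain ⟨N, hN⟩ := hspan g hg
  refine ⟨N, fun E E' h => ?_⟩
  have h1 := (x.dist_apply_le_dist (g := g) E).trans_lt hxg
  have h2 := (x.dist_apply_le_dist (g := g) E').trans_lt hxg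
  rw [← dist_eq_norm]
  calc dist (x E) (x E') ≤ dist (x E) (g E) + dist (g E) (x E') := dist_triangle _ _ _
    _ < ε / 2 + ε / 2 := by
      rw [hN E E' h, dist_comm (g E')]
      exact add_lt_add (by rwa [← hN E E' h]) h2
    _ = ε := add_halves ε

end Family

/-! ### Operators on the spaces of families of finite sets -/

section FamilyOperator

/-- The map `E ↦ {min E}` of the Cantor set. -/
def minMap : C(ℕ → Bool, ℕ → Bool) where
  toFun E n := E n && decide (∀ m < n, E m = false)
  continuous_toFun := by
    refine continuous_pi fun n => IsLocallyConstant.continuous ?_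
    have h : (fun E : ℕ → Bool => E n && decide (∀ m < n, E m = false)) =
        (fun H : Finset ℕ => decide (n ∈ H) && decide (∀ m < n, m ∉ H)) ∘
          fun E => below E (n + 1) := by
      funext E
      have h1 : n ∈ below E (n + 1) ↔ E n = true := by simp [mem_below]
      have h2 : (∀ m < n, m ∉ below E (n + 1)) ↔ ∀ m < n, E m = false := by
        refine forall₂_congr fun m hm => ?_
        rw [mem_below]
        simp [hm.trans n.lt_succ_self]
      simp [h1, h2]
    rw [h]
    exact (isLocallyConstant_below (n + 1)).comp _

theorem minMap_eq (E : ℕ → Bool) : minMap E = cantorPoint ∅ ∨ ∃ n, minMap E = cantorPoint {n} := by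
  by_cases h : ∃ n, E n = true
  · refine Or.inr ⟨Nat.find h, funext fun n => ?_⟩
    change (E n && decide (∀ m < n, E m = false)) = decide (n ∈ ({Nat.find h} : Finset ℕ))
    rw [Bool.eq_iff_iff, Bool.and_eq_true, decide_eq_true_iff, decide_eq_true_iff,
      Finset.mem_singleton, @eq_comm _ n, Nat.find_eq_iff]
    simp
  · push Not at h
    refine Or.inl (funext fun n => ?_)
    change (E n && decide (∀ m < n, E m = false)) = decide (n ∈ (∅ : Finset ℕ))
    have := h n
    simp_all

theorem minMap_cantorPoint_singleton (n : ℕ) : minMap (cantorPoint {n}) = cantorPoint {n} := by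
  funext i
  change (cantorPoint {n} i && decide (∀ m < i, cantorPoint {n} m = false)) = cantorPoint {n} i
  by_cases h : i = n
  · subst h
    simp only [cantorPoint, Finset.mem_singleton, decide_true, Bool.true_and, decide_eq_true_iff,
      decide_eq_false_iff_not]
    exact fun m hm => hm.ne
  · simp [cantorPoint, h]

variable {𝕂 : Type} [RCLike 𝕂]

/-- The code of the restriction to `X` of the composition with `minMap`. -/
noncomputable def minCode (s : DenseSelector 𝕂) (X : SB 𝕂) : OperatorCode s :=
  ⟨(X, ⊤, fun n => ContinuousMap.compCLM 𝕂 𝕂 minMap (s.d n X)), fun _ => trivial, 1, fun n a => by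
    rw [Nat.cast_one, one_mul]
    have h : ∑ i ∈ Finset.range n, a i • ContinuousMap.compCLM 𝕂 𝕂 minMap (s.d i X) =
        ContinuousMap.compCLM 𝕂 𝕂 minMap (∑ i ∈ Finset.range n, a i • s.d i X) := by
      simp
    rw [h]
    refine (ContinuousMap.norm_le _ (norm_nonneg _)).2 fun E => ?_
    exact ContinuousMap.norm_coe_le_norm _ (minMap E)⟩

theorem measurable_minCode (s : DenseSelector 𝕂) : Measurable (minCode s) := by
  refine Measurable.subtype_mk (measurable_id.prodMk (measurable_const.prodMk ?_))
  refine measurable_pi_lambda _ fun n => ?_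
  exact (ContinuousMap.compCLM 𝕂 𝕂 minMap).continuous.measurable.comp (s.measurable n)

theorem minCode_operator_apply (s : DenseSelector 𝕂) (X : SB 𝕂) (x : (minCode s X).dom) :
    ((minCode s X).operator x : CantorC 𝕂) = (x : CantorC 𝕂).comp minMap := by
  have h : (minCode s X).operator =
      ((ContinuousMap.compCLM 𝕂 𝕂 minMap).comp (minCode s X).dom.subtypeL).codRestrict
        (minCode s X).cod fun _ => trivial :=
    ((minCode s X).operator_eq_iff _).2 fun n => rfl
  rw [h]
  rfl

/-- If every infinite set has an infinite subset all of whose finite subsets are in `𝓕`, then the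
operator is completely continuous. -/
theorem isCompletelyContinuous_minCode (s : DenseSelector 𝕂) {𝓕 : Set (Finset ℕ)}
    (h𝓕 : IsLowerSet 𝓕) (hsub : ∀ M : Set ℕ, M.Infinite → ∃ E ⊆ M, E.Infinite ∧
      ∀ H : Finset ℕ, (H : Set ℕ) ⊆ E → H ∈ 𝓕) :
    IsCompletelyContinuous (minCode s (familySpace 𝕂 𝓕)).operator := by
  classical
  intro x hx
  have hmem : ∀ i, (x i : CantorC 𝕂) ∈ familySpace 𝕂 𝓕 := fun i => (x i).2
  have hpt : ∀ E : ℕ → Bool, Tendsto (fun i => ‖(x i : CantorC 𝕂) E‖) atTop (𝓝 0) := fun E => by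
    have := (hx ((ContinuousMap.evalCLM 𝕂 E : CantorC 𝕂 →L[𝕂] 𝕂).comp
      (minCode s (familySpace 𝕂 𝓕)).dom.subtypeL)).norm
    rw [norm_zero] at this
    exact this
  by_contra hcon
  rw [Metric.tendsto_atTop] at hcon
  push Not at hcon
  obtain ⟨δ, hδ, hcon⟩ := hcon
  -- Gliding hump: far out, `x i` is small at the finitely many points below `B` although its image
  -- has norm at least `δ`, so a large coordinate sits at some `n ≥ B`.
  have hstep : ∀ B : ℕ, ∃ i n : ℕ, B ≤ i ∧ B ≤ n ∧ δ / 2 < ‖(x i : CantorC 𝕂) (cantorPoint {n})‖ ∧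
      ∀ H ⊆ Finset.range B, ‖(x i : CantorC 𝕂) (cantorPoint H)‖ < δ / 8 := by
    intro B
    have hev : ∀ᶠ i in atTop, ∀ H ∈ (Finset.range B).powerset,
        ‖(x i : CantorC 𝕂) (cantorPoint H)‖ < δ / 8 :=
      (Finset.eventually_all _).2 fun H _ =>
        (hpt (cantorPoint H)).eventually (gt_mem_nhds (by positivity))
    obtain ⟨N, hN⟩ := eventually_atTop.1 hev
    obtain ⟨i, hi, hδi⟩ := hcon (max B N)
    rw [dist_zero_right] at hδi
    have hsmall := hN i ((le_max_right _ _).trans hi)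
    obtain ⟨E, hE⟩ : ∃ E, δ / 2 < ‖(x i : CantorC 𝕂) (minMap E)‖ := by
      by_contra hle
      push Not at hle
      have h1 : ‖((minCode s (familySpace 𝕂 𝓕)).operator (x i) : CantorC 𝕂)‖ ≤ δ / 2 := by
        rw [minCode_operator_apply]
        exact (ContinuousMap.norm_le _ (by positivity)).2 hle
      exact absurd (hδi.trans (show ‖(minCode s (familySpace 𝕂 𝓕)).operator (x i)‖ ≤ δ / 2 from h1))
        (by linarith)
    rcases minMap_eq E with h0 | ⟨n, hn⟩
    · rw [h0, apply_cantorPoint_empty (hmem i), norm_zero] at hE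
      linarith
    · rw [hn] at hE
      refine ⟨i, n, (le_max_left _ _).trans hi, ?_, hE, fun H hH =>
        hsmall H (Finset.mem_powerset.2 hH)⟩
      by_contra hnB
      have := hsmall {n} (by simpa using hnB)
      linarith
  choose i n hBi hBn hbig hsmall using hstep
  choose N hN using fun j => exists_forall_agree_norm_sub_lt (hmem j)
    (show (0 : ℝ) < δ / 8 by positivity)
  -- The next bound passes the current hump and the stage after which further digits change `x (i
  -- b)` by less than `δ / 8`.
  let B : ℕ → ℕ := fun k => Nat.rec 0 (fun _ b => max (N (i b)) (max (n b + 1) (b + 1))) k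
  have hB : ∀ k, B (k + 1) = max (N (i (B k))) (max (n (B k) + 1) (B k + 1)) := fun k => rfl
  have hBlt : StrictMono B := strictMono_nat_of_lt_succ fun k => by
    rw [hB]
    exact lt_of_lt_of_le (Nat.lt_succ_self _) ((le_max_right _ _).trans (le_max_right _ _))
  have hnlt : ∀ k, n (B k) < B (k + 1) := fun k => by
    rw [hB]
    exact lt_of_lt_of_le (Nat.lt_succ_self _) ((le_max_left _ _).trans (le_max_right _ _))
  have hnmono : StrictMono fun k => n (B k) := strictMono_nat_of_lt_succ fun k =>
    (hnlt k).trans_le (hBn _)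
  obtain ⟨E, hEM, hE, hEF⟩ := hsub _ (Set.infinite_range_of_injective hnmono.injective)
  let Ê : ℕ → Bool := fun j => decide (j ∈ E)
  have hbelow : ∀ k, below Ê k ∈ 𝓕 := fun k => hEF _ fun j hj => by
    simpa [Ê] using (mem_below.1 (Finset.mem_coe.1 hj)).2
  -- Below `B (k + 1)` the point `Ê` consists of its part below `B k` and the hump, so additivity
  -- leaves `δ / 2 - δ / 8 - δ / 8`.
  have hlarge : ∀ k, n (B k) ∈ E → δ / 4 ≤ ‖(x (i (B k)) : CantorC 𝕂) Ê‖ := by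
    intro k hk
    have hins : below Ê (B (k + 1)) = insert (n (B k)) (below Ê (B k)) := by
      ext j
      rw [Finset.mem_insert, mem_below, mem_below]
      constructor
      · rintro ⟨hj, hjE⟩
        obtain ⟨l, rfl⟩ := hEM (by simpa [Ê] using hjE : j ∈ E)
        rcases lt_trichotomy l k with hlk | rfl | hlk
        · exact Or.inr ⟨(hnlt l).trans_le (hBlt.monotone (Nat.succ_le_of_lt hlk)), hjE⟩
        · exact Or.inl rfl
        · exact absurd (hj.trans_le (hBlt.monotone (Nat.succ_le_of_lt hlk))) (hBn (B l)).not_gt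
      · rintro (rfl | ⟨hj, hjE⟩)
        · exact ⟨hnlt k, by simpa [Ê] using hk⟩
        · exact ⟨hj.trans (hBlt k.lt_succ_self), hjE⟩
    have hnot : n (B k) ∉ below Ê (B k) := fun h => (mem_below.1 h).1.not_ge (hBn _)
    have h1 := apply_cantorPoint_insert h𝓕 (hmem (i (B k))) hnot (hins ▸ hbelow (B (k + 1)))
    have h2 := hsmall (B k) (below Ê (B k)) (Finset.filter_subset _ _)
    have h3 := hbig (B k)
    have h4 := hN (i (B k)) Ê (cantorPoint (insert (n (B k)) (below Ê (B k)))) fun j hj => by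
      have hj' : j < B (k + 1) := hj.trans_le (by rw [hB]; exact le_max_left _ _)
      rw [← hins]
      simp [cantorPoint, mem_below, hj', Ê]
    rw [h1] at h4
    have h5 : ‖(x (i (B k)) : CantorC 𝕂) (cantorPoint {n (B k)})‖ ≤
        ‖(x (i (B k)) : CantorC 𝕂) Ê‖ + ‖(x (i (B k)) : CantorC 𝕂) Ê -
          ((x (i (B k)) : CantorC 𝕂) (cantorPoint (below Ê (B k))) +
            (x (i (B k)) : CantorC 𝕂) (cantorPoint {n (B k)}))‖ +
          ‖(x (i (B k)) : CantorC 𝕂) (cantorPoint (below Ê (B k)))‖ := by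
      refine le_trans (le_of_eq ?_) ((norm_sub_le _ _).trans
        (add_le_add_left (norm_sub_le _ _) _))
      congr 1
      ring
    linarith
  have hev := (hpt Ê).eventually (gt_mem_nhds (show (0 : ℝ) < δ / 4 by positivity))
  obtain ⟨j₀, hj₀⟩ := eventually_atTop.1 hev
  obtain ⟨j, hjE, hj⟩ := hE.exists_gt (n (B j₀))
  obtain ⟨k, rfl⟩ := hEM hjE
  have hk : j₀ < k := hnmono.lt_iff_lt.1 hj
  exact (hlarge k hjE).not_gt (hj₀ _ (hk.le.trans ((hBlt.le_apply).trans (hBi _))))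

/-- If some infinite set has no infinite subset all of whose finite subsets are in `𝓕`, then the
operator is not completely continuous. -/
theorem not_isCompletelyContinuous_minCode (s : DenseSelector 𝕂) {𝓕 : Set (Finset ℕ)}
    (h𝓕 : IsLowerSet 𝓕) (hsingle : ∀ n, {n} ∈ 𝓕) {n : ℕ → ℕ}
    (hsub : ∀ K : Set ℕ, K.Infinite → ∃ H : Finset ℕ, (H : Set ℕ) ⊆ n '' K ∧ H ∉ 𝓕) :
    ¬ IsCompletelyContinuous (minCode s (familySpace 𝕂 𝓕)).operator := by
  intro hcc
  let x : ℕ → (minCode s (familySpace 𝕂 𝓕)).dom := fun k =>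
    ⟨basisFun 𝕂 𝓕 (n k), basisFun_mem_familySpace 𝓕 (n k)⟩
  -- A point lying in these clopen sets for all `k` in an infinite `K` would, by heredity, put every
  -- finite subset of `n '' K` in `𝓕`. Point-finiteness makes the basis functions weakly null.
  have hfin : ∀ E, {k | E ∈ basisClopen 𝓕 (n k)}.Finite := by
    intro E
    by_contra hinf
    obtain ⟨H, hH, hHF⟩ := hsub _ hinf
    have hne : H.Nonempty := by
      rw [Finset.nonempty_iff_ne_empty]
      rintro rfl
      exact hHF (h𝓕 (Finset.empty_subset {0}) (hsingle 0))
    obtain ⟨k, hk, hkmax⟩ := hH (H.max'_mem hne)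
    refine hHF (h𝓕 (fun j hj => ?_) (mem_basisClopen.1 hk).2)
    obtain ⟨l, hl, rfl⟩ := hH hj
    rw [mem_below]
    refine ⟨Nat.lt_succ_of_le ?_, (mem_basisClopen.1 hl).1⟩
    rw [hkmax]
    exact H.le_max' _ hj
  have hx : IsWeaklyNull 𝕂 x := by
    intro φ
    obtain ⟨ψ, hψ, -⟩ := exists_extension_norm_eq _ φ
    refine (tendsto_apply_clopenIndicator ψ hfin).congr fun k => ?_
    exact hψ (x k)
  have h := (hcc x hx).norm
  rw [norm_zero] at h
  refine (ge_of_tendsto' h (b := 1) fun k => ?_).not_gt one_pos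
  change 1 ≤ ‖((minCode s (familySpace 𝕂 𝓕)).operator (x k) : CantorC 𝕂)‖
  rw [minCode_operator_apply]
  refine le_trans (le_of_eq ?_)
    (ContinuousMap.norm_coe_le_norm ((x k : CantorC 𝕂).comp minMap) (cantorPoint {n k}))
  rw [ContinuousMap.comp_apply, minMap_cantorPoint_singleton]
  change 1 = ‖basisFun 𝕂 𝓕 (n k) (cantorPoint {n k})‖
  rw [basisFun_cantorPoint h𝓕 (hsingle _)]
  simp

end FamilyOperator

/-! ### Families of finite sets of nodes of the tree of finite sequences -/

section Tree

/-- The finite sequence with a given code. -/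
def node (n : ℕ) : List ℕ := Denumerable.ofNat (List ℕ) n

/-- The node `n` is an initial segment of `σ`. -/
def IsNodeOf (n : ℕ) (σ : ℕ → ℕ) : Prop := ∀ i < (node n).length, (node n)[i]? = some (σ i)

/-- The code of the initial segment of length `k` of `σ`. -/
def nodeOf (σ : ℕ → ℕ) (k : ℕ) : ℕ := Encodable.encode ((List.range k).map σ)

theorem node_nodeOf (σ : ℕ → ℕ) (k : ℕ) : node (nodeOf σ k) = (List.range k).map σ :=
  Denumerable.ofNat_encode _

theorem length_node_nodeOf (σ : ℕ → ℕ) (k : ℕ) : (node (nodeOf σ k)).length = k := by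
  simp [node_nodeOf]

theorem nodeOf_injective (σ : ℕ → ℕ) : Function.Injective (nodeOf σ) := fun k l h => by
  rw [← length_node_nodeOf σ k, h, length_node_nodeOf]

theorem node_nodeOf_prefix (σ : ℕ → ℕ) {k l : ℕ} (h : k ≤ l) :
    node (nodeOf σ k) <+: node (nodeOf σ l) := by
  rw [node_nodeOf, node_nodeOf]
  refine List.IsPrefix.map σ ?_
  obtain ⟨d, rfl⟩ := Nat.exists_eq_add_of_le h
  rw [List.range_add]
  exact List.prefix_append _ _

theorem IsNodeOf.eq_of_nodeOf {σ σ' : ℕ → ℕ} {k : ℕ} (h : IsNodeOf (nodeOf σ k) σ') {i : ℕ}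
    (hi : i < k) : σ' i = σ i := by
  have h1 := h i (by rwa [length_node_nodeOf])
  rw [node_nodeOf] at h1
  simpa [hi] using h1.symm

/-- A sequence of distinct nodes, each an initial segment of the following ones, lies on a
branch. -/
theorem exists_isNodeOf_of_prefix {g : ℕ → ℕ} (hg : Function.Injective g)
    (h : ∀ m n, m < n → node (g m) <+: node (g n)) :
    ∃ σ, (∀ k, IsNodeOf (g k) σ) ∧ StrictMono fun k => (node (g k)).length := by
  have hlen : StrictMono fun k => (node (g k)).length := fun m n hmn => by
    refine lt_of_le_of_ne (h m n hmn).length_le fun heq => ?_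
    have h1 : node (g m) = node (g n) := (h m n hmn).eq_of_length heq
    have h2 := congrArg Encodable.encode h1
    rw [node, node, Denumerable.encode_ofNat, Denumerable.encode_ofNat] at h2
    exact hmn.ne (hg h2)
  have hle : ∀ k, k ≤ (node (g k)).length := fun k => hlen.le_apply
  have hpre : ∀ m n i, m ≤ n → i < (node (g m)).length → (node (g n))[i]? = (node (g m))[i]? := by
    intro m n i hmn hi
    rcases hmn.eq_or_lt with rfl | hmn
    · rfl
    · rw [List.getElem?_eq_getElem hi]
      exact List.prefix_iff_getElem?.1 (h m n hmn) i hi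
  refine ⟨fun i => (node (g (i + 1))).getD i 0, fun k i hi => ?_, hlen⟩
  have hi' : i < (node (g (i + 1))).length := (Nat.lt_succ_self i).trans_le (hle _)
  have h1 : (node (g (i + 1)))[i]? = (node (g k))[i]? := by
    rcases le_total k (i + 1) with hk | hk
    · exact hpre k (i + 1) i hk hi
    · exact (hpre (i + 1) k i hk hi').symm
  rw [← h1]
  beta_reduce
  rw [List.getD_eq_getElem?_getD, List.getElem?_eq_getElem hi']
  rfl

variable {Y : Type} [MetricSpace Y]

/-- The family attached to a closed set `D`, a continuous map `p` and a point `y`. -/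
def treeFamily (D : Set ((ℕ → ℕ) × (ℕ → ℕ))) (p : (ℕ → ℕ) → Y) (y : Y) : Set (Finset ℕ) :=
  {E | (∀ a ∈ E, ∀ b ∈ E, a < b → ¬ node a <+: node b) ∨
    (∃ q ∈ D, (∀ a ∈ E, IsNodeOf a q.1) ∧ ∀ a ∈ E, ∀ b ∈ E,
      (node a).length < (node b).length → ∀ j ≤ (node a).length, q.2 j ≤ (node b).length) ∨
    ∃ σ, (∀ a ∈ E, IsNodeOf a σ) ∧ ∀ a ∈ E, 1 / (((node a).length : ℝ) + 1) < dist (p σ) y}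

variable {D : Set ((ℕ → ℕ) × (ℕ → ℕ))} {p : (ℕ → ℕ) → Y} {y : Y}

theorem isLowerSet_treeFamily : IsLowerSet (treeFamily D p y) := by
  rintro E E' hE (h | ⟨q, hq, h1, h2⟩ | ⟨σ, h1, h2⟩)
  · exact Or.inl fun a ha b hb => h a (hE ha) b (hE hb)
  · exact Or.inr (Or.inl ⟨q, hq, fun a ha => h1 a (hE ha), fun a ha b hb => h2 a (hE ha) b (hE hb)⟩)
  · exact Or.inr (Or.inr ⟨σ, fun a ha => h1 a (hE ha), fun a ha => h2 a (hE ha)⟩)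

theorem singleton_mem_treeFamily (n : ℕ) : {n} ∈ treeFamily D p y := by
  refine Or.inl fun a ha b hb hab => ?_
  rw [Finset.mem_singleton] at ha hb
  omega

/-- Only the third alternative depends on `y`, and it is open in `y`. -/
theorem measurableSet_mem_treeFamily [MeasurableSpace Y] [BorelSpace Y] (E : Finset ℕ) :
    MeasurableSet {y | E ∈ treeFamily D p y} := by
  refine (MeasurableSet.const _).union ((MeasurableSet.const _).union ?_)
  have : IsOpen {y | ∃ σ, (∀ a ∈ E, IsNodeOf a σ) ∧
      ∀ a ∈ E, 1 / (((node a).length : ℝ) + 1) < dist (p σ) y} := by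
    have heq : {y | ∃ σ, (∀ a ∈ E, IsNodeOf a σ) ∧
        ∀ a ∈ E, 1 / (((node a).length : ℝ) + 1) < dist (p σ) y} =
        ⋃ σ : {σ : ℕ → ℕ // ∀ a ∈ E, IsNodeOf a σ},
          ⋂ a ∈ E, {y | 1 / (((node a).length : ℝ) + 1) < dist (p σ.1) y} := by
      ext y
      simp
    rw [heq]
    exact isOpen_iUnion fun σ => isOpen_biInter_finset fun a _ =>
      isOpen_lt continuous_const (continuous_const.dist continuous_id)
  exact this.measurableSet

/-- If `y` is only attained by `p` at points of the projection of `D`, then every infinite set has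
an infinite subset all of whose finite subsets are in the family. -/
theorem exists_infinite_forall_mem_treeFamily (hy : ∀ σ, p σ = y → ∃ τ, (σ, τ) ∈ D) {M : Set ℕ}
    (hM : M.Infinite) : ∃ E ⊆ M, E.Infinite ∧
      ∀ H : Finset ℕ, (H : Set ℕ) ⊆ E → H ∈ treeFamily D p y := by
  obtain ⟨e, he, heM⟩ := Nat.exists_strictMono_subsequence (P := (· ∈ M)) fun n => by
    obtain ⟨b, hb, hnb⟩ := hM.exists_gt n
    exact ⟨b, hnb, hb⟩
  let r : ℕ → ℕ → Prop := fun a b => node a <+: node b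
  have : IsTrans ℕ r := ⟨fun a b c hab hbc => List.IsPrefix.trans hab hbc⟩
  -- Ramsey for pairs: either an infinite chain, which determines a branch, or no node is a prefix
  -- of a later one.
  obtain ⟨φ, hφ | hφ⟩ := exists_increasing_or_nonincreasing_subseq r e
  · have hmono : StrictMono fun k => e (φ k) := he.comp φ.strictMono
    obtain ⟨σ, hσ, hlen⟩ := exists_isNodeOf_of_prefix hmono.injective hφ
    by_cases hp : p σ = y
    · obtain ⟨τ, hτ⟩ := hy σ hp
      let ℓ : ℕ → ℕ := fun k => (node (e (φ k))).length
      -- The chain is thinned until each length bounds the values of `τ` up to the preceding length.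
      let ψ : ℕ → ℕ := fun k => Nat.rec 0
        (fun _ b => max (b + 1) ((Finset.range (ℓ b + 1)).sup τ)) k
      have hψ : ∀ k, ψ (k + 1) = max (ψ k + 1) ((Finset.range (ℓ (ψ k) + 1)).sup τ) :=
        fun k => rfl
      have hψmono : StrictMono ψ := strictMono_nat_of_lt_succ fun k => by
        rw [hψ]
        exact lt_of_lt_of_le (Nat.lt_succ_self _) (le_max_left _ _)
      refine ⟨Set.range fun k => e (φ (ψ k)), ?_,
        Set.infinite_range_of_injective (hmono.comp hψmono).injective, fun H hH => ?_⟩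
      · rintro _ ⟨k, rfl⟩
        exact heM _
      · refine Or.inr (Or.inl ⟨(σ, τ), hτ, fun a ha => ?_, fun a ha b hb hab j hj => ?_⟩)
        · obtain ⟨k, rfl⟩ := hH ha
          exact hσ _
        · obtain ⟨k, rfl⟩ := hH ha
          obtain ⟨l, rfl⟩ := hH hb
          have hkl : k < l := (hlen.comp hψmono).lt_iff_lt.1 hab
          have h1 : τ j ≤ (Finset.range (ℓ (ψ k) + 1)).sup τ :=
            Finset.le_sup (Finset.mem_range.2 (Nat.lt_succ_of_le hj))
          have h2 : (Finset.range (ℓ (ψ k) + 1)).sup τ ≤ ψ (k + 1) := by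
            rw [hψ]
            exact le_max_right _ _
          exact (h1.trans h2).trans ((hψmono.monotone (Nat.succ_le_of_lt hkl)).trans
            hlen.le_apply)
    · obtain ⟨k₀, hk₀⟩ := exists_nat_one_div_lt (dist_pos.2 hp)
      refine ⟨Set.range fun k => e (φ (k + k₀)), ?_, Set.infinite_range_of_injective
        (hmono.injective.comp (add_left_injective k₀)), fun H hH => ?_⟩
      · rintro _ ⟨k, rfl⟩
        exact heM _
      · refine Or.inr (Or.inr ⟨σ, fun a ha => ?_, fun a ha => ?_⟩)
        · obtain ⟨k, rfl⟩ := hH ha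
          exact hσ _
        · obtain ⟨k, rfl⟩ := hH ha
          refine lt_of_le_of_lt (one_div_le_one_div_of_le (by positivity) ?_) hk₀
          have h1 : k + k₀ ≤ (node (e (φ (k + k₀)))).length := hlen.le_apply
          have h2 : k₀ ≤ (node (e (φ (k + k₀)))).length := by omega
          have h3 : (k₀ : ℝ) ≤ (node (e (φ (k + k₀)))).length := by exact_mod_cast h2
          linarith
  · have hmono : StrictMono fun k => e (φ k) := he.comp φ.strictMono
    refine ⟨Set.range fun k => e (φ k), ?_, Set.infinite_range_of_injective hmono.injective,
      fun H hH => Or.inl fun a ha b hb hab => ?_⟩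
    · rintro _ ⟨k, rfl⟩
      exact heM _
    · obtain ⟨k, rfl⟩ := hH ha
      obtain ⟨l, rfl⟩ := hH hb
      exact hφ k l (hmono.lt_iff_lt.1 hab)

/-- If `p σ = y` and `σ` is not in the projection of `D`, then no infinite set of nodes of `σ` has
all its finite subsets in the family. -/
theorem exists_finset_notMem_treeFamily (hD : IsClosed D) (hp : Continuous p) {σ : ℕ → ℕ}
    (hσ : p σ = y) (hσD : ∀ τ, (σ, τ) ∉ D) {K : Set ℕ} (hK : K.Infinite) :
    ∃ H : Finset ℕ, (H : Set ℕ) ⊆ nodeOf σ '' K ∧ H ∉ treeFamily D p y := by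
  classical
  by_contra hcon
  push Not at hcon
  obtain ⟨e, he, heK⟩ := Nat.exists_strictMono_subsequence (P := (· ∈ K)) fun n => by
    obtain ⟨b, hb, hnb⟩ := hK.exists_gt n
    exact ⟨b, hnb, hb⟩
  let H : ℕ → Finset ℕ := fun j => (Finset.range (j + 1)).image fun i => nodeOf σ (e i)
  have hmem : ∀ i j, i ≤ j → nodeOf σ (e i) ∈ H j := fun i j hij =>
    Finset.mem_image_of_mem _ (Finset.mem_range.2 (Nat.lt_succ_of_le hij))
  have hHmono : ∀ i j, i ≤ j → H i ⊆ H j := fun i j hij =>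
    Finset.image_subset_image (Finset.range_mono (Nat.succ_le_succ hij))
  have hH : ∀ j, H j ∈ treeFamily D p y := fun j => hcon _ fun a ha => by
    obtain ⟨i, -, rfl⟩ := Finset.mem_image.1 (Finset.mem_coe.1 ha)
    exact ⟨e i, heK i, rfl⟩
  have hagree : ∀ j (σ' : ℕ → ℕ), (∀ a ∈ H j, IsNodeOf a σ') → ∀ i < j, σ' i = σ i := by
    intro j σ' h i hi
    exact (h _ (hmem j j le_rfl)).eq_of_nodeOf (hi.trans_le he.le_apply)
  have hlim : ∀ (σ' : ℕ → ℕ → ℕ) (f : ℕ → ℕ), (∀ j, j ≤ f j) →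
      (∀ j, ∀ a ∈ H (f j), IsNodeOf a (σ' j)) → Tendsto σ' atTop (𝓝 σ) := by
    intro σ' f hf h
    rw [tendsto_pi_nhds]
    intro i
    refine tendsto_const_nhds.congr' ?_
    filter_upwards [eventually_gt_atTop i] with j hj
    exact (hagree _ _ (h j) i (hj.trans_le (hf j))).symm
  have hanti : ∃ j₀, ∀ j ≥ j₀, ¬ ∀ a ∈ H j, ∀ b ∈ H j, a < b → ¬ node a <+: node b := by
    have hinf : (Set.range fun i => nodeOf σ (e i)).Infinite :=
      Set.infinite_range_of_injective ((nodeOf_injective σ).comp he.injective)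
    obtain ⟨_, ⟨i, rfl⟩, hi⟩ := hinf.exists_gt (nodeOf σ (e 0))
    exact ⟨i, fun j hj h => h _ (hmem 0 j j.zero_le) _ (hmem i j hj) hi
      (node_nodeOf_prefix σ (he.monotone i.zero_le))⟩
  obtain ⟨j₀, hj₀⟩ := hanti
  -- Branches witnessing the third alternative for all `j` would converge to `σ`, so their images
  -- would tend to `y`, yet the fixed node `nodeOf σ (e 0)` keeps them at a positive distance.
  by_cases hb : ∀ j, ∃ σ', (∀ a ∈ H j, IsNodeOf a σ') ∧
      ∀ a ∈ H j, 1 / (((node a).length : ℝ) + 1) < dist (p σ') y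
  · choose σ' hσ' hdist using hb
    have h1 := (hp.tendsto σ).comp (hlim σ' id (fun _ => le_rfl) hσ')
    rw [hσ] at h1
    have h2 := tendsto_iff_dist_tendsto_zero.1 h1
    have h3 := ge_of_tendsto' h2 fun j => (hdist j _ (hmem 0 j j.zero_le)).le
    exact h3.not_gt Nat.one_div_pos_of_nat
  · push Not at hb
    obtain ⟨j₁, hj₁⟩ := hb
    -- The `H j` increase, so the first alternative fails from `j₀` on and the third from `j₁` on.
    have ha : ∀ j, ∃ q ∈ D, (∀ a ∈ H (j + max j₀ j₁), IsNodeOf a q.1) ∧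
        ∀ a ∈ H (j + max j₀ j₁), ∀ b ∈ H (j + max j₀ j₁),
          (node a).length < (node b).length → ∀ i ≤ (node a).length, q.2 i ≤ (node b).length := by
      intro j
      rcases hH (j + max j₀ j₁) with h | h | ⟨σ', h1, h2⟩
      · exact absurd h (hj₀ _ ((le_max_left _ _).trans (Nat.le_add_left _ _)))
      · exact h
      · have hle : j₁ ≤ j + max j₀ j₁ := (le_max_right _ _).trans (Nat.le_add_left _ _)
        obtain ⟨a, ha, h3⟩ := hj₁ σ' fun a ha => h1 a (hHmono _ _ hle ha)
        exact absurd (h2 a (hHmono _ _ hle ha)) h3.not_gt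
    choose q hqD hq hqτ using ha
    -- The growth condition at the nodes of lengths `e i` and `e (i + 1)` bounds the `i`-th value by
    -- `e (i + 1)` once `j > i`. The witnesses therefore stay in a compact box, and a limit point
    -- puts `σ` in the projection of the closed set `D`.
    have hbound : ∀ i, ∃ B, ∀ j, (q j).2 i ≤ B := by
      intro i
      refine ⟨max (e (i + 1)) ((Finset.range (i + 1)).sup fun j => (q j).2 i), fun j => ?_⟩
      rcases Nat.lt_or_ge j (i + 1) with hj | hj
      · exact (Finset.le_sup (f := fun j => (q j).2 i) (Finset.mem_range.2 hj)).trans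
          (le_max_right _ _)
      · refine le_trans ?_ (le_max_left _ _)
        have hj' : i + 1 ≤ j + max j₀ j₁ := hj.trans (Nat.le_add_right _ _)
        have h1 := hqτ j _ (hmem i _ (i.le_succ.trans hj')) _ (hmem (i + 1) _ hj')
        rw [length_node_nodeOf, length_node_nodeOf] at h1
        exact h1 (he i.lt_succ_self) i he.le_apply
    choose B hB using hbound
    have hcomp : IsCompact (Set.univ.pi fun i => Set.Iic (B i)) :=
      isCompact_univ_pi fun i => (Set.finite_Iic (B i)).isCompact
    obtain ⟨τ, -, φ, hφ, hτ⟩ := hcomp.tendsto_subseq (x := fun j => (q j).2)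
      fun j i _ => hB i j
    have h1 : Tendsto (fun j => (q (φ j)).1) atTop (𝓝 σ) :=
      (hlim (fun j => (q j).1) (fun j => j + max j₀ j₁) (fun j => Nat.le_add_right _ _) hq).comp
        hφ.tendsto_atTop
    exact hσD τ (hD.mem_of_tendsto (h1.prodMk_nhds hτ) (Eventually.of_forall fun j => hqD _))

end Tree

/-! ### Completeness -/

/-- The Polish space in the definition is parametrised by the Baire space, and the analytic
complement of the coanalytic set is pulled back to a projection of a closed set. -/
theorem IsSigma12.exists_continuous_isClosed {Y : Type} [TopologicalSpace Y] [T2Space Y]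
    [Nonempty Y] {A : Set Y} (h : IsSigma12 A) :
    ∃ (p : (ℕ → ℕ) → Y) (D : Set ((ℕ → ℕ) × (ℕ → ℕ))), Continuous p ∧ IsClosed D ∧
      A = {y | ∃ σ, p σ = y ∧ ∀ τ, (σ, τ) ∉ D} := by
  obtain ⟨Z, _, _, B, f, hB, hf, rfl⟩ := h
  rcases isEmpty_or_nonempty Z with hZ | hZ
  · refine ⟨fun _ => Classical.arbitrary Y, Set.univ, continuous_const, isClosed_univ, ?_⟩
    ext y
    simp
  · obtain ⟨g, hg, hgs⟩ := PolishSpace.exists_nat_nat_continuous_surjective Z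
    obtain ⟨D, hD, hDB⟩ := (AnalyticSet.preimage hB hg).exists_isClosed_image_fst
    refine ⟨f ∘ g, D, hf.comp hg, hD, ?_⟩
    have hiff : ∀ σ, g σ ∈ B ↔ ∀ τ, (σ, τ) ∉ D := by
      intro σ
      rw [← not_iff_not, ← Set.mem_compl_iff, ← Set.mem_preimage, ← hDB]
      simp
    ext y
    constructor
    · rintro ⟨z, hz, rfl⟩
      obtain ⟨σ, rfl⟩ := hgs z
      exact ⟨σ, rfl, (hiff σ).1 hz⟩
    · rintro ⟨σ, rfl, hσ⟩
      exact ⟨g σ, (hiff σ).2 hσ, rfl⟩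

section Completeness

variable {𝕂 : Type} [RCLike 𝕂] {s : DenseSelector 𝕂}

theorem IsPi12.borelReducible_completelyContinuousCodes [TopologicalSpace (OperatorCode s)]
    [BorelSpace (OperatorCode s)] {Y : Type} [TopologicalSpace Y] [PolishSpace Y] {A : Set Y}
    (hA : IsPi12 A) : BorelReducible A (completelyContinuousCodes s) := by
  rcases isEmpty_or_nonempty Y with hY | hY
  · exact ⟨isEmptyElim, fun T _ => by
      rw [Set.eq_empty_of_isEmpty (isEmptyElim ⁻¹' T)]
      exact @MeasurableSet.empty Y (borel Y), Subsingleton.elim _ _⟩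
  let := TopologicalSpace.metrizableSpaceMetric Y
  obtain ⟨p, D, hp, hD, hpD⟩ := IsSigma12.exists_continuous_isClosed hA
  borelize Y
  refine ⟨fun y => minCode s (familySpace 𝕂 (treeFamily D p y)), ?_, ?_⟩
  · rw [← BorelSpace.measurable_eq (α := OperatorCode s)]
    exact (measurable_minCode s).comp (measurable_familySpace measurableSet_mem_treeFamily)
  · ext y
    rw [Set.mem_preimage, completelyContinuousCodes, Set.mem_ofPred_eq, ← not_iff_not,
      ← Set.mem_compl_iff, hpD, Set.mem_ofPred_eq]
    constructor
    · intro h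
      by_contra hcon
      push Not at hcon
      exact h (isCompletelyContinuous_minCode s isLowerSet_treeFamily fun M hM =>
        exists_infinite_forall_mem_treeFamily hcon hM)
    · rintro ⟨σ, hσ, hσD⟩
      exact not_isCompletelyContinuous_minCode s isLowerSet_treeFamily singleton_mem_treeFamily
        fun K hK => exists_finset_notMem_treeFamily hD hp hσ hσD hK

end Completeness

theorem mainTheorem11 (𝕂 : Type) [RCLike 𝕂] (s : DenseSelector 𝕂) :
    StandardBorelSpace (OperatorCode s) ∧
    ∀ [TopologicalSpace (OperatorCode s)] [PolishSpace (OperatorCode s)]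
      [BorelSpace (OperatorCode s)],
      IsPi12 (completelyContinuousCodes s) ∧
      IsPi12Complete (completelyContinuousCodes s) ∧
      ¬ IsPi11 (completelyContinuousCodes s) ∧
      ∀ S : Ordinal.{0} → Set (Finset ℕ+), IsSchreierSystem S →
        ∀ ξ : Ordinal.{0}, 0 < ξ → ξ < Ordinal.omega 1 →
          IsPi11 (familyCompletelyContinuousCodes s (S ξ)) ∧
          BorelReducible (familyCompletelyContinuousCodes s (S ξ))
            (completelyContinuousCodes s) ∧
          ¬ BorelReducible (completelyContinuousCodes s)
            (familyCompletelyContinuousCodes s (S ξ)) := by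
  refine ⟨standardBorelSpace_operatorCode s, ?_⟩
  intro _ _ _
  have hpi : IsPi12 (completelyContinuousCodes s) := isPi12_completelyContinuousCodes
  have hnot : ¬ IsPi11 (completelyContinuousCodes s) := by
    intro h
    obtain ⟨A, hA, hAnot⟩ := exists_analyticSet_not_isPi11
    exact hAnot (h.of_borelReducible
      (isPi12_of_analyticSet hA).borelReducible_completelyContinuousCodes)
  refine ⟨hpi, ⟨hpi, fun Y _ _ A hA => hA.borelReducible_completelyContinuousCodes⟩, hnot, ?_⟩
  intro S hS ξ hξ hξ1
  obtain ⟨𝓖, h𝓖⟩ := (hS.isSchreierFamily ξ hξ1).2 hξ.ne'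
  have h11 := isPi11_familyCompletelyContinuousCodes (s := s) hξ.ne' h𝓖
  exact ⟨h11, (isPi12_of_isPi11 h11).borelReducible_completelyContinuousCodes,
    fun h => hnot (IsPi11.of_borelReducible h h11)⟩
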